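/- Let $d\ge 1$. A state on $\mathbb{C}^d$ is a positive semidefinite $d\times d$ matrix of trace $1$; it is pure if moreover $\operatorname{tr}(\rho^2)=1$. The trace distance of two states is $\|\rho-\sigma\|_{\mathrm{tr}}$, where $\|M\|_{\mathrm{tr}}:=\tfrac12\operatorname{tr}\sqrt{MM^\dagger}$. For a finite label set $X$, a *probabilistic encoding* of the pure states on $\mathbb{C}^d$ with precision $\varepsilon$ is a family of states $(\rho_x)_{x\in X}$ on $\mathbb{C}^d$, with its classical-quantum channel $\Gamma(\sigma)=\sum_{x\in X}\langle x|\sigma|x\rangle\rho_x$, such that for every pure state $\phi$ on $\mathbb{C}^d$ there is a state $\sigma$ on $\mathbb{C}^{X}$ with $\|\phi-\Gamma(\sigma)\|_{\mathrm{tr}}<\varepsilon$. It is a *deterministic encoding* if for every pure $\phi$ there is $x\in X$ with $\|\phi-\rho_x\|_{\mathrm{tr}}<\varepsilon$. Let $N_{\mathrm{prob}}(d,\varepsilon)$ and $N_{\mathrm{det}}(d,\varepsilon)$ be the minimum of $|X|$ over probabilistic, respectively deterministic, encodings with precision $\varepsilon$, and let $n_{\mathrm{prob}}=\lceil\log_2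 N_{\mathrm{prob}}\rceil$ and $n_{\mathrm{det}}=\lceil\log_2 N_{\mathrm{det}}\rceil$ be the corresponding bit lengths. For all $d\ge2$ and $\varepsilon\in(0,1]$ both minima exist (that is, encodings with finite label sets exist), and $$(d-1)\log_2\tfrac1\varepsilon-\log_2 d\;\le\;\log_2 N_{\mathrm{prob}}(d,\varepsilon)\;\le\;(d-1)\log_2\tfrac1\varepsilon+\log_2(5d\ln d).$$ Asymptotically the bit rate of the most compact probabilistic encoding is half of that of the most compact deterministic encoding: - per dimension, $\lim_{d\to\infty} n_{\mathrm{prob}}(d,\varepsilon)/d=\log_2\frac1\varepsilon$ for every $\varepsilon\in(0,1]$, and $\lim_{d\to\infty} n_{\mathrm{det}}(d,\varepsilon)/d=2\log_2\frac1\varepsilon$ for every $\varepsilon\in(0,\frac12]$; - per precision, $\lim_{\varepsilon\downarrow0} n_{\mathrm{prob}}(d,\varepsilon)/(-\log_2\varepsilon)=d-1$ and $\lim_{\varepsilon\downarrow0} n_{\mathrm{det}}(d,\varepsilon)/(-\log_2\varepsilon)=2(d-1)$ for every $d\ge2$. -/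

import Mathlib

open Filter Topology
open scoped ComplexOrder

noncomputable section

/-- Quantum states (density matrices) on the Hilbert space with orthonormal basis indexed by `ι`. -/
def IsState {ι : Type*} [Fintype ι] (ρ : Matrix ι ι ℂ) : Prop :=
  ρ.PosSemidef ∧ ρ.trace = 1

/-- Pure states: states `φ` with `tr (φ²) = 1`. -/
def IsPureState {ι : Type*} [Fintype ι] (φ : Matrix ι ι ℂ) : Prop :=
  IsState φ ∧ (φ * φ).trace = 1

/-- The normalized Schatten 1-norm `(1/2) tr √(M M†)`; the trace distance of two states
`ρ`, `σ` is `halfTraceNorm (ρ - σ)`. -/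
def halfTraceNorm {ι : Type*} [Fintype ι] [DecidableEq ι] (M : Matrix ι ι ℂ) : ℝ :=
  (1 / 2) * (cfc Real.sqrt (M * M.conjTranspose)).trace.re

/-- The classical-quantum channel `Γ(σ) = ∑ₓ ⟨x|σ|x⟩ ρₓ` attached to matrices `ρₓ`, where
`|x⟩` is the standard basis of `ℂ^X`. -/
def cqChannel {X ι : Type*} [Fintype X] (ρ : X → Matrix ι ι ℂ) (σ : Matrix X X ℂ) :
    Matrix ι ι ℂ :=
  ∑ x, σ x x • ρ x

/-- A probabilistic encoding of the pure states on `ℂ^d` with label set `X` and precision `ε`. -/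
def ProbabilisticEncoding (d : ℕ) (X : Type*) [Fintype X] (ε : ℝ) : Prop :=
  ∃ ρ : X → Matrix (Fin d) (Fin d) ℂ, (∀ x, IsState (ρ x)) ∧
    ∀ φ : Matrix (Fin d) (Fin d) ℂ, IsPureState φ →
      ∃ σ : Matrix X X ℂ, IsState σ ∧ halfTraceNorm (φ - cqChannel ρ σ) < ε

/-- A deterministic encoding of the pure states on `ℂ^d` with label set `X` and precision `ε`
(an external `ε`-covering). -/
def DeterministicEncoding (d : ℕ) (X : Type*) [Fintype X] (ε : ℝ) : Prop :=
  ∃ ρ : X → Matrix (Fin d) (Fin d) ℂ, (∀ x, IsState (ρ x)) ∧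
    ∀ φ : Matrix (Fin d) (Fin d) ℂ, IsPureState φ →
      ∃ x, halfTraceNorm (φ - ρ x) < ε

/-- The possible numbers of labels of probabilistic encodings. -/
def probabilisticSizes (d : ℕ) (ε : ℝ) : Set ℕ :=
  {N | ProbabilisticEncoding d (Fin N) ε}

/-- The possible numbers of labels of deterministic encodings. -/
def deterministicSizes (d : ℕ) (ε : ℝ) : Set ℕ :=
  {N | DeterministicEncoding d (Fin N) ε}

/-- Number of labels of the most compact probabilistic encoding. -/
def minProbabilisticSize (d : ℕ) (ε : ℝ) : ℕ := sInf (probabilisticSizes d ε)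

/-- Number of labels of the most compact deterministic encoding. -/
def minDeterministicSize (d : ℕ) (ε : ℝ) : ℕ := sInf (deterministicSizes d ε)

/-- Number `⌈log₂ N⌉` of bits needed to store one of `N` labels. -/
def bitLength (N : ℕ) : ℕ := ⌈Real.logb 2 N⌉₊

end

/-! Write `d = n + 1`. Pure states are lines in `ℂ^d`; a set of them is measured through its cone
under the standard Gaussian, which is unitarily invariant. The squared moduli of the coordinates are
independent exponential variables, so the cone of lines whose overlap with a fixed line exceeds `1 -
s` has measure exactly `s ^ n` (`gaussianVec_overlapCap`).

A rank one projector minus a state has at most one positive eigenvalue (`eigenvalues_pos_unique`),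
so the trace distance from a pure state to a state is the largest value of the quadratic form of the
difference on unit vectors. All estimates go through such test vectors.

Probabilistic case. If a mixture of the `ρ x` is `ε`-close to the projector on `u`, testing on `u`
itself gives some `x` with `⟨u|ρ x|u⟩ > 1 - ε`. In an eigenbasis of `ρ x` this puts `u` in one of
`d` caps, of total measure at most `d ε ^ n`, whence the lower bound. Conversely, let finitely many
pure states meet every pure state with overlap above `1 - ε`. Sion's minimax theorem reduces the
choice of a mixture to answering each witness `τ` separately, and the label near the top eigenvector
of `τ` answers it. So overlap `1 - ε` suffices.

Deterministic case. Now one label has to pass all tests at once. The test vector `(ρ + ε)⁻¹ w`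
confines the ball around `ρ` to a quadratic cone of measure at most `e ε ^ (2n)` when `ε ≤ 1/2`.
Conversely, overlap above `1 - ε²` with a pure state gives trace distance below `ε`. Thus `ε²`
replaces `ε`, which is the factor two.

Both upper bounds use one covering theorem: overlap above `1 - s` is achieved with at most `5 d ln d
/ s ^ n` states. Greedily chosen smaller balls cover almost everything, and a maximal separated set
of uncovered points finishes. All errors in the bit lengths are then at most `2 log₂ d + 4`,
uniformly in the relevant `ε`, which gives both kinds of limits. -/

/-! ### Gaussian measure on `ℂ^d` and its unitary invariance -/

open MeasureTheory ENNReal in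
theorem lintegral_fin_prod_eq_prod {n : ℕ} {E : Type*} [MeasurableSpace E]
    (μ : Fin n → Measure E) [∀ i, SigmaFinite (μ i)] (f : Fin n → E → ℝ≥0∞)
    (hf : ∀ i, Measurable (f i)) :
    ∫⁻ x, ∏ i, f i (x i) ∂Measure.pi μ = ∏ i, ∫⁻ x, f i x ∂μ i := by
  induction n with
  | zero => simp
  | succ n ih =>
    rw [← ((measurePreserving_piFinSuccAbove μ 0).symm).lintegral_comp_emb
      (MeasurableEquiv.measurableEmbedding _), Fin.prod_univ_succ]
    simp_rw [MeasurableEquiv.piFinSuccAbove_symm_apply, Fin.insertNthEquiv,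
      Fin.prod_univ_succ, Fin.insertNth_zero, Equiv.coe_fn_mk, Fin.cons_succ,
      Fin.zero_succAbove, Fin.cons_zero, cast_eq]
    rw [← ih (fun i => μ (Fin.succ i)) (fun i => f (Fin.succ i)) (fun i => hf (Fin.succ i))]
    exact lintegral_prod_mul (hf 0).aemeasurable
      (Finset.measurable_prod _ fun i _ =>
        (hf (Fin.succ i)).comp (measurable_pi_apply i)).aemeasurable

/-- Density of the standard complex Gaussian. -/
noncomputable def complexGaussianDensity (z : ℂ) : ENNReal :=
  ENNReal.ofReal (Real.pi⁻¹ * Real.exp (-‖z‖ ^ 2))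

theorem measurable_complexGaussianDensity : Measurable complexGaussianDensity := by
  unfold complexGaussianDensity; fun_prop

open MeasureTheory in
/-- The standard Gaussian measure on `ℂ`. -/
noncomputable def complexGaussian : Measure ℂ := volume.withDensity complexGaussianDensity

open MeasureTheory in
/-- The Laplace transform of `‖z‖²`. -/
theorem lintegral_complexGaussian_exp {b : ℝ} (hb : 0 ≤ b) :
    ∫⁻ z, ENNReal.ofReal (Real.exp (-(b * ‖z‖ ^ 2))) ∂complexGaussian =
      ENNReal.ofReal (1 / (1 + b)) := by
  have h := Complex.integral_exp_neg_mul_rpow (p := 2) (b := 1 + b) (by norm_num) (by linarith)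
  have hint : Integrable (fun z : ℂ => Real.exp (-(1 + b) * ‖z‖ ^ (2 : ℝ))) := by
    -- A non-integrable function would have the default integral `0`, contradicting the positive
    -- value in `h`.
    by_contra hc
    rw [integral_undef hc] at h
    have : 0 < Real.pi * (1 + b) ^ (-2 / 2 : ℝ) * Real.Gamma (2 / 2 + 1) := by
      have := Real.Gamma_pos_of_pos (s := 2 / 2 + 1) (by norm_num)
      have := Real.rpow_pos_of_pos (x := 1 + b) (by linarith) (-2 / 2 : ℝ)
      have := Real.pi_pos
      positivity
    linarith
  rw [complexGaussian, lintegral_withDensity_eq_lintegral_mul _ measurable_complexGaussianDensity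
    (by fun_prop)]
  have e : ∀ z : ℂ, (complexGaussianDensity * fun z : ℂ =>
      ENNReal.ofReal (Real.exp (-(b * ‖z‖ ^ 2)))) z
      = ENNReal.ofReal (Real.pi⁻¹ * Real.exp (-(1 + b) * ‖z‖ ^ (2 : ℝ))) := by
    intro z
    rw [Pi.mul_apply, complexGaussianDensity, ← ENNReal.ofReal_mul (by positivity), mul_assoc,
      ← Real.exp_add]
    congr 3
    rw [Real.rpow_two]; ring
  simp_rw [e]
  rw [← ofReal_integral_eq_lintegral_ofReal (hint.const_mul _)
    (Eventually.of_forall fun z => by positivity), integral_const_mul, h]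
  congr 1
  have : (-2 / 2 : ℝ) = -1 := by norm_num
  rw [this, Real.rpow_neg_one]
  have : (2 / 2 + 1 : ℝ) = 2 := by norm_num
  rw [this, Real.Gamma_two]
  have := Real.pi_pos
  field_simp

open MeasureTheory in
instance : IsProbabilityMeasure complexGaussian := ⟨by
  have := lintegral_complexGaussian_exp le_rfl
  simpa using this⟩

open MeasureTheory Set in
/-- `‖z‖²` is exponentially distributed. -/
theorem complexGaussian_lt_sq {r : ℝ} (hr : 0 ≤ r) :
    complexGaussian {z | r < ‖z‖ ^ 2} = ENNReal.ofReal (Real.exp (-r)) := by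
  have hm : MeasurableSet {z : ℂ | r < ‖z‖ ^ 2} := measurableSet_lt (by fun_prop) (by fun_prop)
  rw [complexGaussian, withDensity_apply _ hm, ← lintegral_indicator hm,
    ← Complex.lintegral_comp_polarCoord_symm, polarCoord_target, Measure.volume_eq_prod,
    ← Measure.prod_restrict]
  -- The radial factor of the integral in polar coordinates; the angle contributes `2π`.
  have key : ∫⁻ x in Ioi 0, ENNReal.ofReal x * (Ioi (√r)).indicator
      (fun x => ENNReal.ofReal (Real.pi⁻¹ * Real.exp (-x ^ 2))) x
      = ENNReal.ofReal (Real.exp (-r) / (2 * Real.pi)) := by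
    have hd : ∀ x ∈ Ici (√r), HasDerivAt (fun x : ℝ => -(Real.exp (-x ^ 2) / (2 * Real.pi)))
        (x * (Real.pi⁻¹ * Real.exp (-x ^ 2))) x := by
      intro x _
      have := (((hasDerivAt_pow 2 x).neg.exp).div_const (2 * Real.pi)).neg
      refine this.congr_deriv ?_
      have := Real.pi_pos
      field_simp
      simp
      ring
    have hpos : ∀ x ∈ Ioi (√r), 0 ≤ x * (Real.pi⁻¹ * Real.exp (-x ^ 2)) := fun x hx => by
      have : 0 ≤ x := (Real.sqrt_nonneg r).trans (le_of_lt hx)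
      have := Real.pi_pos
      positivity
    have ht : Tendsto (fun x : ℝ => -(Real.exp (-x ^ 2) / (2 * Real.pi))) atTop (𝓝 0) := by
      have h1 : Tendsto (fun x : ℝ => Real.exp (-x ^ 2)) atTop (𝓝 0) :=
        Real.tendsto_exp_neg_atTop_nhds_zero.comp (tendsto_pow_atTop (by norm_num))
      simpa using (h1.div_const (2 * Real.pi)).neg
    have hi := integrableOn_Ioi_deriv_of_nonneg' hd hpos ht
    have hI := integral_Ioi_of_hasDerivAt_of_nonneg' hd hpos ht
    have : ∀ x, ENNReal.ofReal x * (Ioi (√r)).indicator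
      (fun x => ENNReal.ofReal (Real.pi⁻¹ * Real.exp (-x ^ 2))) x =
      (Ioi (√r)).indicator (fun x => ENNReal.ofReal (x * (Real.pi⁻¹ * Real.exp (-x ^ 2)))) x := by
      intro x
      by_cases hx : x ∈ Ioi (√r)
      · rw [indicator_of_mem hx, indicator_of_mem hx,
          ENNReal.ofReal_mul (p := x)]
        exact (Real.sqrt_nonneg r).trans (le_of_lt hx)
      · simp [indicator_of_notMem hx]
    simp_rw [this]
    rw [lintegral_indicator measurableSet_Ioi, Measure.restrict_restrict measurableSet_Ioi,
      inter_eq_left.2 (Ioi_subset_Ioi (Real.sqrt_nonneg r)),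
      ← ofReal_integral_eq_lintegral_ofReal hi
        ((ae_restrict_iff' measurableSet_Ioi).2 (Eventually.of_forall hpos)), hI]
    simp [Real.sq_sqrt hr]
  have e : ∀ p : ℝ × ℝ, p ∈ Ioi (0 : ℝ) ×ˢ Ioo (-Real.pi) Real.pi →
      ENNReal.ofReal p.1 • ({z : ℂ | r < ‖z‖ ^ 2}.indicator complexGaussianDensity)
        (Complex.polarCoord.symm p) =
      (ENNReal.ofReal p.1 * (Ioi (√r)).indicator
        (fun x => ENNReal.ofReal (Real.pi⁻¹ * Real.exp (-x ^ 2))) p.1) * 1 := by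
    intro p hp
    have hp1 : 0 < p.1 := hp.1
    rw [mul_one, smul_eq_mul]
    congr 1
    simp only [indicator, mem_ofPred_eq, Complex.norm_polarCoord_symm, sq_abs, mem_Ioi,
      Real.sqrt_lt' hp1, complexGaussianDensity]
  have hms : MeasurableSet (Ioi (0 : ℝ) ×ˢ Ioo (-Real.pi) Real.pi) :=
    measurableSet_Ioi.prod measurableSet_Ioo
  rw [Measure.prod_restrict, setLIntegral_congr_fun hms e, ← Measure.prod_restrict,
    lintegral_prod_mul (f := fun x => ENNReal.ofReal x * (Ioi (√r)).indicator
      (fun x => ENNReal.ofReal (Real.pi⁻¹ * Real.exp (-x ^ 2))) x) (g := fun _ => 1), key]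
  · simp only [lintegral_const, MeasurableSet.univ, Measure.restrict_apply, univ_inter,
      Real.volume_Ioo, one_mul]
    rw [← ENNReal.ofReal_mul (by have := Real.pi_pos; positivity)]
    congr 1
    have := Real.pi_pos
    field_simp
    ring
  · apply Measurable.aemeasurable
    refine Measurable.mul (by fun_prop) (Measurable.indicator (by fun_prop) measurableSet_Ioi)
  · exact aemeasurable_const

open MeasureTheory in
/-- The standard Gaussian measure on `ℂ^d`. -/
noncomputable def gaussianVec (d : ℕ) : Measure (Fin d → ℂ) := Measure.pi fun _ => complexGaussian

open MeasureTheory in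
instance (d : ℕ) : IsProbabilityMeasure (gaussianVec d) := by
  unfold gaussianVec; infer_instance

open MeasureTheory in
theorem gaussianVec_eq_withDensity (d : ℕ) :
    gaussianVec d = volume.withDensity fun z => ∏ i, complexGaussianDensity (z i) := by
  refine (Measure.pi_eq fun s hs => ?_)
  rw [withDensity_apply _ (MeasurableSet.univ_pi hs), volume_pi, Measure.restrict_pi_pi,
    lintegral_fin_prod_eq_prod _ _ fun _ => measurable_complexGaussianDensity]
  exact Finset.prod_congr rfl fun i _ => (withDensity_apply _ (hs i)).symm

theorem prod_complexGaussianDensity {d : ℕ} (z : Fin d → ℂ) :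
    ∏ i, complexGaussianDensity (z i) =
      ENNReal.ofReal (Real.pi⁻¹ ^ d * Real.exp (-∑ i, ‖z i‖ ^ 2)) := by
  simp only [complexGaussianDensity]
  rw [← ENNReal.ofReal_prod_of_nonneg (fun i _ => by have := Real.pi_pos; positivity),
    Finset.prod_mul_distrib, ← Real.exp_sum]
  simp

open MeasureTheory in
theorem gaussianVec_singleton_zero {d : ℕ} (hd : 0 < d) : gaussianVec d {0} = 0 := by
  have : Nonempty (Fin d) := ⟨⟨0, hd⟩⟩
  rw [gaussianVec_eq_withDensity]
  exact withDensity_absolutelyContinuous _ _ (measure_singleton _)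

-- Given the other coordinates `w`, the exponential variable `‖z i‖ ^ 2` exceeds the required
-- threshold with probability `exp (-∑ b j / a * ‖w j‖ ^ 2)`. Integrating over `w` gives a product
-- of Laplace transforms. Every volume below is an instance of this formula.
open MeasureTheory in
theorem gaussianVec_quadratic {n : ℕ} (i : Fin (n + 1)) {a : ℝ} (ha : 0 < a) (b : Fin n → ℝ)
    (hb : ∀ j, 0 ≤ b j) :
    gaussianVec (n + 1) {z | ∑ j, b j * ‖z (i.succAbove j)‖ ^ 2 < a * ‖z i‖ ^ 2} =
      ∏ j, ENNReal.ofReal (a / (a + b j)) := by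
  have hT : MeasurableSet {p : ℂ × (Fin n → ℂ) | ∑ j, b j * ‖p.2 j‖ ^ 2 < a * ‖p.1‖ ^ 2} :=
    measurableSet_lt (by fun_prop) (by fun_prop)
  have h := (measurePreserving_piFinSuccAbove (fun _ : Fin (n + 1) => complexGaussian)
    i).measure_preimage hT.nullMeasurableSet
  have hpre : (MeasurableEquiv.piFinSuccAbove (fun _ : Fin (n + 1) => ℂ) i) ⁻¹'
      {p : ℂ × (Fin n → ℂ) | ∑ j, b j * ‖p.2 j‖ ^ 2 < a * ‖p.1‖ ^ 2} =
      {z | ∑ j, b j * ‖z (i.succAbove j)‖ ^ 2 < a * ‖z i‖ ^ 2} := by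
    ext z; rfl
  rw [hpre] at h
  rw [gaussianVec, h, Measure.prod_apply_symm hT]
  have e : ∀ w : Fin n → ℂ, complexGaussian ((fun z => (z, w)) ⁻¹'
      {p : ℂ × (Fin n → ℂ) | ∑ j, b j * ‖p.2 j‖ ^ 2 < a * ‖p.1‖ ^ 2}) =
      ∏ j, ENNReal.ofReal (Real.exp (-(b j / a * ‖w j‖ ^ 2))) := by
    intro w
    have : (fun z => (z, w)) ⁻¹'
      {p : ℂ × (Fin n → ℂ) | ∑ j, b j * ‖p.2 j‖ ^ 2 < a * ‖p.1‖ ^ 2} =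
      {z : ℂ | ∑ j, b j / a * ‖w j‖ ^ 2 < ‖z‖ ^ 2} := by
      ext z
      simp only [Set.mem_preimage, Set.mem_ofPred_eq]
      rw [← div_lt_iff₀' ha, Finset.sum_div]
      simp only [div_mul_eq_mul_div]
    rw [this, complexGaussian_lt_sq (Finset.sum_nonneg fun j _ => by have := hb j; positivity),
      ← Finset.sum_neg_distrib, Real.exp_sum,
      ENNReal.ofReal_prod_of_nonneg fun j _ => (Real.exp_pos _).le]
  simp_rw [e]
  rw [lintegral_fin_prod_eq_prod _ (fun j z => ENNReal.ofReal (Real.exp (-(b j / a * ‖z‖ ^ 2))))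
    (fun j => by fun_prop)]
  refine Finset.prod_congr rfl fun j _ => ?_
  rw [lintegral_complexGaussian_exp (by have := hb j; positivity)]
  congr 1
  have := hb j
  field_simp

open MeasureTheory in
theorem volume_preserving_mulVec_unitary {d : ℕ} {U : Matrix (Fin d) (Fin d) ℂ}
    (hU : U ∈ Matrix.unitaryGroup (Fin d) ℂ) :
    MeasurePreserving (fun z : Fin d → ℂ => U.mulVec z) volume volume := by
  let f : (Fin d → ℂ) →ₗ[ℝ] (Fin d → ℂ) := (Matrix.toLin' U).restrictScalars ℝ
  -- The real determinant of a complex linear map is the squared modulus of the complex one.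
  have hdet : LinearMap.det f = 1 := by
    rw [LinearMap.det_restrictScalars, LinearMap.det_toLin', Algebra.norm_complex_apply]
    have h1 := (Matrix.mem_unitaryGroup_iff.1 hU)
    have h2 := congrArg Matrix.det h1
    rw [Matrix.det_mul, Matrix.star_eq_conjTranspose, Matrix.det_conjTranspose,
      Matrix.det_one] at h2
    have h3 : ((Complex.normSq U.det : ℝ) : ℂ) = 1 := by
      rw [← Complex.mul_conj]; exact h2
    exact_mod_cast h3
  refine ⟨by fun_prop, ?_⟩
  have := Measure.map_linearMap_addHaar_eq_smul_addHaar (volume : Measure (Fin d → ℂ)) (f := f)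
    (by rw [hdet]; norm_num)
  rw [hdet] at this
  have h : Measure.map (⇑f) volume = volume := by simpa using this
  exact h

theorem sum_norm_sq_mulVec_unitary {d : ℕ} {U : Matrix (Fin d) (Fin d) ℂ}
    (hU : U ∈ Matrix.unitaryGroup (Fin d) ℂ) (z : Fin d → ℂ) :
    ∑ i, ‖U.mulVec z i‖ ^ 2 = ∑ i, ‖z i‖ ^ 2 := by
  have h : ∀ w : Fin d → ℂ, ((∑ i, ‖w i‖ ^ 2 : ℝ) : ℂ) = star w ⬝ᵥ w := by
    intro w
    simp [dotProduct, Complex.conj_mul']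
  have : ((∑ i, ‖U.mulVec z i‖ ^ 2 : ℝ) : ℂ) = ((∑ i, ‖z i‖ ^ 2 : ℝ) : ℂ) := by
    rw [h, h, Matrix.star_mulVec, ← Matrix.dotProduct_mulVec, Matrix.mulVec_mulVec,
      ← Matrix.star_eq_conjTranspose, Matrix.mem_unitaryGroup_iff'.1 hU, Matrix.one_mulVec]
  exact_mod_cast this

open MeasureTheory in
theorem gaussianVec_preserving_mulVec_unitary {d : ℕ} {U : Matrix (Fin d) (Fin d) ℂ}
    (hU : U ∈ Matrix.unitaryGroup (Fin d) ℂ) :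
    MeasurePreserving (fun z : Fin d → ℂ => U.mulVec z) (gaussianVec d) (gaussianVec d) := by
  have hv := volume_preserving_mulVec_unitary hU
  refine ⟨hv.measurable, Measure.ext fun s hs => ?_⟩
  rw [Measure.map_apply hv.measurable hs, gaussianVec_eq_withDensity,
    withDensity_apply _ (hv.measurable hs), withDensity_apply _ hs,
    ← hv.setLIntegral_comp_preimage hs]
  · refine lintegral_congr fun z => ?_
    rw [prod_complexGaussianDensity, prod_complexGaussianDensity, sum_norm_sq_mulVec_unitary hU]
  · exact Finset.measurable_prod _ fun i _ =>
      measurable_complexGaussianDensity.comp (measurable_pi_apply i)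

/-! ### Trace distance through quadratic forms -/

section

open Matrix

theorem trace_cfc_eq_sum {ι : Type*} [Fintype ι] [DecidableEq ι] {A : Matrix ι ι ℂ}
    (hA : A.IsHermitian) (f : ℝ → ℝ) : (cfc f A).trace = ∑ i, (f (hA.eigenvalues i) : ℂ) := by
  rw [hA.cfc_eq, IsHermitian.cfc, Unitary.conjStarAlgAut_apply, trace_mul_cycle,
    Unitary.coe_star_mul_self, one_mul, trace_diagonal]
  rfl

theorem trace_re_eq_sum_eigenvalues {ι : Type*} [Fintype ι] [DecidableEq ι] {A : Matrix ι ι ℂ}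
    (hA : A.IsHermitian) : A.trace.re = ∑ i, hA.eigenvalues i := by
  rw [hA.trace_eq_sum_eigenvalues]; simp

theorem halfTraceNorm_eq_sum_abs {ι : Type*} [Fintype ι] [DecidableEq ι] {A : Matrix ι ι ℂ}
    (hA : A.IsHermitian) : halfTraceNorm A = (1 / 2) * ∑ i, |hA.eigenvalues i| := by
  have hs : IsSelfAdjoint A := hA
  have h : cfc Real.sqrt (A * A.conjTranspose) = cfc (fun x : ℝ => |x|) A := by
    rw [hA.eq, ← sq]
    conv_lhs => rw [← cfc_pow_id (R := ℝ) A 2 hs]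
    rw [← cfc_comp' Real.sqrt (fun x => x ^ 2) A]
    simp [Real.sqrt_sq_eq_abs]
  rw [halfTraceNorm, h, trace_cfc_eq_sum hA]
  simp

/-- The squared Euclidean norm of a complex vector. -/
noncomputable def normSqVec {ι : Type*} [Fintype ι] (v : ι → ℂ) : ℝ := ∑ i, ‖v i‖ ^ 2

theorem star_dotProduct_self {ι : Type*} [Fintype ι] (v : ι → ℂ) :
    star v ⬝ᵥ v = (normSqVec v : ℂ) := by
  simp [normSqVec, dotProduct, Complex.conj_mul']

theorem normSqVec_pos {ι : Type*} [Fintype ι] {v : ι → ℂ} (hv : v ≠ 0) : 0 < normSqVec v := by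
  obtain ⟨i, hi⟩ := Function.ne_iff.1 hv
  exact Finset.sum_pos' (fun i _ => by positivity)
    ⟨i, Finset.mem_univ i, by have : 0 < ‖v i‖ := norm_pos_iff.2 hi
                              positivity⟩

theorem normSqVec_smul {ι : Type*} [Fintype ι] (c : ℂ) (v : ι → ℂ) :
    normSqVec (c • v) = ‖c‖ ^ 2 * normSqVec v := by
  simp [normSqVec, mul_pow, Finset.mul_sum]

theorem normSqVec_mulVec_of_star_mul_self {ι : Type*} [Fintype ι] [DecidableEq ι]
    {U : Matrix ι ι ℂ} (hU : star U * U = 1) (v : ι → ℂ) :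
    normSqVec (U *ᵥ v) = normSqVec v := by
  have : ((normSqVec (U *ᵥ v) : ℝ) : ℂ) = (normSqVec v : ℝ) := by
    rw [← star_dotProduct_self, ← star_dotProduct_self, star_mulVec, ← dotProduct_mulVec,
      mulVec_mulVec, ← star_eq_conjTranspose, hU, one_mulVec]
  exact_mod_cast this

/-- The real part of the quadratic form of a matrix. -/
noncomputable def quadForm {ι : Type*} [Fintype ι] (A : Matrix ι ι ℂ) (v : ι → ℂ) : ℝ :=
  (star v ⬝ᵥ A *ᵥ v).re

theorem quadForm_sub {ι : Type*} [Fintype ι] (A B : Matrix ι ι ℂ) (v : ι → ℂ) :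
    quadForm (A - B) v = quadForm A v - quadForm B v := by
  simp [quadForm, sub_mulVec, dotProduct_sub]

theorem quadForm_eq_sum {ι : Type*} [Fintype ι] [DecidableEq ι] {A : Matrix ι ι ℂ}
    (hA : A.IsHermitian) (v : ι → ℂ) :
    quadForm A v = ∑ i, hA.eigenvalues i *
      ‖(star (hA.eigenvectorUnitary : Matrix ι ι ℂ) *ᵥ v) i‖ ^ 2 := by
  set w := star (hA.eigenvectorUnitary : Matrix ι ι ℂ) *ᵥ v with hw
  have h : star v ⬝ᵥ A *ᵥ v = star w ⬝ᵥ (diagonal (RCLike.ofReal ∘ hA.eigenvalues) *ᵥ w) := by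
    conv_lhs => rw [hA.spectral_theorem, Unitary.conjStarAlgAut_apply]
    rw [hw, star_mulVec, star_eq_conjTranspose, conjTranspose_conjTranspose, ← dotProduct_mulVec,
      mulVec_mulVec, mulVec_mulVec]
  rw [quadForm, h]
  simp only [dotProduct, mulVec_diagonal, Complex.re_sum, Pi.star_apply, Function.comp_apply]
  refine Finset.sum_congr rfl fun i _ => ?_
  have : star (w i) * ((hA.eigenvalues i : ℂ) * w i) =
      ((hA.eigenvalues i * ‖w i‖ ^ 2 : ℝ) : ℂ) := by
    push_cast
    rw [← Complex.conj_mul', Complex.star_def]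
    ring
  exact (congrArg Complex.re this).trans (Complex.ofReal_re _)

theorem normSqVec_star_eigenvectorUnitary_mulVec {ι : Type*} [Fintype ι] [DecidableEq ι]
    {A : Matrix ι ι ℂ} (hA : A.IsHermitian) (v : ι → ℂ) :
    normSqVec (star (hA.eigenvectorUnitary : Matrix ι ι ℂ) *ᵥ v) = normSqVec v :=
  normSqVec_mulVec_of_star_mul_self (by simp) v

theorem quadForm_nonneg {ι : Type*} [Fintype ι] {A : Matrix ι ι ℂ} (hA : A.PosSemidef)
    (v : ι → ℂ) : 0 ≤ quadForm A v :=
  (Complex.le_def.1 (hA.dotProduct_mulVec_nonneg v)).1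

theorem quadForm_vecMulVec {ι : Type*} [Fintype ι] (u v : ι → ℂ) :
    quadForm (vecMulVec u (star u)) v = ‖star u ⬝ᵥ v‖ ^ 2 := by
  have : star v ⬝ᵥ vecMulVec u (star u) *ᵥ v = ((‖star u ⬝ᵥ v‖ ^ 2 : ℝ) : ℂ) := by
    rw [vecMulVec_mulVec, dotProduct_smul, op_smul_eq_smul, smul_eq_mul]
    have : star v ⬝ᵥ u = star (star u ⬝ᵥ v) := by rw [star_dotProduct]
    rw [this, Complex.star_def, Complex.mul_conj']
    push_cast; rfl
  rw [quadForm, this, Complex.ofReal_re]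

/-- For trace zero the positive and negative parts of the spectrum have equal mass, so half the
total mass is the positive part. -/
theorem halfTraceNorm_eq_sum_max {ι : Type*} [Fintype ι] [DecidableEq ι] {A : Matrix ι ι ℂ}
    (hA : A.IsHermitian) (h0 : A.trace = 0) :
    halfTraceNorm A = ∑ i, max (hA.eigenvalues i) 0 := by
  have h1 : ∑ i, hA.eigenvalues i = 0 := by rw [← trace_re_eq_sum_eigenvalues, h0]; rfl
  have : ∀ x : ℝ, max x 0 = (1 / 2) * |x| + (1 / 2) * x := fun x => by
    rcases le_total 0 x with h | h
    · rw [max_eq_left h, abs_of_nonneg h]; ring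
    · rw [max_eq_right h, abs_of_nonpos h]; ring
  simp_rw [this, Finset.sum_add_distrib, ← Finset.mul_sum]
  rw [h1, halfTraceNorm_eq_sum_abs hA]; ring

theorem eigenvalues_le_halfTraceNorm {ι : Type*} [Fintype ι] [DecidableEq ι] {A : Matrix ι ι ℂ}
    (hA : A.IsHermitian) (h0 : A.trace = 0) (i : ι) : hA.eigenvalues i ≤ halfTraceNorm A := by
  rw [halfTraceNorm_eq_sum_max hA h0]
  exact (le_max_left _ 0).trans
    (Finset.single_le_sum (f := fun i => max (hA.eigenvalues i) 0)
      (fun i _ => le_max_right _ _) (Finset.mem_univ i))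

theorem quadForm_lt_of_eigenvalues_lt {ι : Type*} [Fintype ι] [DecidableEq ι] {A : Matrix ι ι ℂ}
    (hA : A.IsHermitian) {ε : ℝ} (h : ∀ i, hA.eigenvalues i < ε) {v : ι → ℂ} (hv : v ≠ 0) :
    quadForm A v < ε * normSqVec v := by
  have hp := normSqVec_pos hv
  rw [← normSqVec_star_eigenvectorUnitary_mulVec hA] at hp ⊢
  rw [quadForm_eq_sum hA, normSqVec, Finset.mul_sum]
  obtain ⟨i, hi⟩ : ∃ i, 0 < ‖(star (hA.eigenvectorUnitary : Matrix ι ι ℂ) *ᵥ v) i‖ ^ 2 := by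
    by_contra! hc
    exact hp.not_ge (Finset.sum_nonpos fun i _ => hc i)
  exact Finset.sum_lt_sum (fun i _ => mul_le_mul_of_nonneg_right (h i).le (by positivity))
    ⟨i, Finset.mem_univ i, mul_lt_mul_of_pos_right (h i) hi⟩

theorem quadForm_lt_of_halfTraceNorm_lt {ι : Type*} [Fintype ι] [DecidableEq ι]
    {φ ρ : Matrix ι ι ℂ} (hφ : IsState φ) (hρ : IsState ρ) {ε : ℝ}
    (h : halfTraceNorm (φ - ρ) < ε) {v : ι → ℂ} (hv : v ≠ 0) :
    quadForm φ v - quadForm ρ v < ε * normSqVec v := by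
  have hA : (φ - ρ).IsHermitian := hφ.1.isHermitian.sub hρ.1.isHermitian
  rw [← quadForm_sub]
  exact quadForm_lt_of_eigenvalues_lt hA (fun i => (eigenvalues_le_halfTraceNorm hA
    (by rw [trace_sub, hφ.2, hρ.2, sub_self]) i).trans_lt h) hv

theorem quadForm_eigenvector_combination {ι : Type*} [Fintype ι] [DecidableEq ι]
    {A : Matrix ι ι ℂ} (hA : A.IsHermitian) (c : ι → ℂ) :
    quadForm A ((hA.eigenvectorUnitary : Matrix ι ι ℂ) *ᵥ c) =
      ∑ i, hA.eigenvalues i * ‖c i‖ ^ 2 := by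
  rw [quadForm_eq_sum hA, mulVec_mulVec]
  simp

/-- Subtracting a state from a rank one projector leaves at most one positive eigenvalue. -/
theorem eigenvalues_pos_unique {ι : Type*} [Fintype ι] [DecidableEq ι] {u : ι → ℂ}
    {ρ : Matrix ι ι ℂ} (hρ : ρ.PosSemidef) (hA : (vecMulVec u (star u) - ρ).IsHermitian)
    {i j : ι} (hi : 0 < hA.eigenvalues i) (hj : 0 < hA.eigenvalues j) : i = j := by
  by_contra hij
  set U : Matrix ι ι ℂ := (hA.eigenvectorUnitary : Matrix ι ι ℂ)
  have hU : star U * U = 1 := by simp [U]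
  set a := star u ᵥ* U with ha
  have key : ∀ c : ι → ℂ, a ⬝ᵥ c = 0 → ∑ k, hA.eigenvalues k * ‖c k‖ ^ 2 ≤ 0 := by
    intro c hc
    rw [← quadForm_eigenvector_combination hA, quadForm_sub, quadForm_vecMulVec,
      dotProduct_mulVec, ← ha, hc]
    have := quadForm_nonneg hρ (U *ᵥ c)
    simpa using this
  -- An eigenvector orthogonal to `u` sees only `-ρ`, so its eigenvalue cannot be positive.
  have hai : a i ≠ 0 := by
    intro h
    have := key (Pi.single i 1) (by simp [h])
    rw [Finset.sum_eq_single i (fun k _ hk => by simp [hk]) (by simp)] at this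
    simp at this
    linarith
  -- The combination of the two eigenvectors that is orthogonal to `u`: the form is nonpositive
  -- there, while two positive eigenvalues would make it positive.
  have := key (Pi.single i (a j) + Pi.single j (-a i)) (by
    rw [dotProduct_add, dotProduct_single, dotProduct_single]; ring)
  rw [Finset.sum_eq_add i j hij (fun k _ hk => by simp [hk.1, hk.2]) (by simp) (by simp)] at this
  simp [hij, Ne.symm hij] at this
  have h1 : 0 < ‖a i‖ := norm_pos_iff.2 hai
  have h2 : 0 < hA.eigenvalues j * ‖a i‖ ^ 2 := by positivity
  have h3 : 0 ≤ hA.eigenvalues i * ‖a j‖ ^ 2 := by positivity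
  linarith

/-- With at most one positive eigenvalue, the sum of positive parts is a single eigenvalue, attained
by testing on its eigenvector. If there is none, the distance is `0` and `0 < ε` is used. -/
theorem halfTraceNorm_lt_of_quadForm_lt {ι : Type*} [Fintype ι] [DecidableEq ι] {u : ι → ℂ}
    {ρ : Matrix ι ι ℂ} (hφ : IsState (vecMulVec u (star u))) (hρ : IsState ρ) {ε : ℝ}
    (hε : 0 < ε)
    (h : ∀ v, normSqVec v = 1 → quadForm (vecMulVec u (star u)) v - quadForm ρ v < ε) :
    halfTraceNorm (vecMulVec u (star u) - ρ) < ε := by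
  have hA : (vecMulVec u (star u) - ρ).IsHermitian := hφ.1.isHermitian.sub hρ.1.isHermitian
  have hev : ∀ i, hA.eigenvalues i < ε := by
    intro i
    have := h ((hA.eigenvectorUnitary : Matrix ι ι ℂ) *ᵥ Pi.single i 1) (by
      rw [normSqVec_mulVec_of_star_mul_self (by simp), normSqVec,
        Finset.sum_eq_single i (fun k _ hk => by simp [hk]) (by simp)]
      simp)
    rw [← quadForm_sub, quadForm_eigenvector_combination hA,
      Finset.sum_eq_single i (fun k _ hk => by simp [hk]) (by simp)] at this
    simpa using this
  rw [halfTraceNorm_eq_sum_max hA (by rw [trace_sub, hφ.2, hρ.2, sub_self])]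
  by_cases hp : ∃ i, 0 < hA.eigenvalues i
  · obtain ⟨i, hi⟩ := hp
    rw [Finset.sum_eq_single i (fun k _ hk => max_eq_right (not_lt.1 fun hk' =>
      hk (eigenvalues_pos_unique hρ.1 hA hk' hi))) (by simp), max_eq_left hi.le]
    exact hev i
  · push Not at hp
    rw [Finset.sum_eq_zero fun i _ => max_eq_right (hp i)]
    exact hε

theorem isPureState_vecMulVec {ι : Type*} [Fintype ι] {u : ι → ℂ} (hu : normSqVec u = 1) :
    IsPureState (vecMulVec u (star u)) := by
  have h1 : u ⬝ᵥ star u = 1 := by rw [dotProduct_comm, star_dotProduct_self, hu]; simp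
  have h2 : star u ⬝ᵥ u = 1 := by rw [star_dotProduct_self, hu]; simp
  refine ⟨⟨posSemidef_vecMulVec_self_star u, by rw [trace_vecMulVec, h1]⟩, ?_⟩
  rw [vecMulVec_mul_vecMulVec, h2, one_smul, trace_vecMulVec, h1]

/-- The eigenvalues lie in `[0, 1]` and both they and their squares sum to `1`, so each `λ (1 - λ)`
vanishes. -/
theorem IsPureState.exists_eigenvalues {ι : Type*} [Fintype ι] [DecidableEq ι]
    {φ : Matrix ι ι ℂ} (hφ : IsPureState φ) (hA : φ.IsHermitian) :
    ∃ i, hA.eigenvalues i = 1 ∧ ∀ j, j ≠ i → hA.eigenvalues j = 0 := by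
  have hs : IsSelfAdjoint φ := hA
  have h1 : ∑ i, hA.eigenvalues i = 1 := by
    rw [← trace_re_eq_sum_eigenvalues, hφ.1.2]; simp
  have h2 : ∑ i, hA.eigenvalues i ^ 2 = 1 := by
    have h := hφ.2
    rw [← sq, ← cfc_pow_id (R := ℝ) φ 2 hs, trace_cfc_eq_sum hA] at h
    exact_mod_cast h
  have h0 : ∀ i, 0 ≤ hA.eigenvalues i := hφ.1.1.eigenvalues_nonneg
  have hle : ∀ i, hA.eigenvalues i ≤ 1 := fun i => h1 ▸
    Finset.single_le_sum (f := hA.eigenvalues) (fun i _ => h0 i) (Finset.mem_univ i)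
  have h3 : ∀ i, hA.eigenvalues i * (1 - hA.eigenvalues i) = 0 := by
    have : ∑ i, hA.eigenvalues i * (1 - hA.eigenvalues i) = 0 := by
      simp_rw [mul_sub, mul_one, Finset.sum_sub_distrib, ← sq]
      rw [h1, h2, sub_self]
    intro i
    exact (Finset.sum_eq_zero_iff_of_nonneg (fun i _ =>
      mul_nonneg (h0 i) (sub_nonneg.2 (hle i)))).1 this i (Finset.mem_univ i)
  obtain ⟨i, hi⟩ : ∃ i, hA.eigenvalues i ≠ 0 := by
    by_contra! hc
    simp [hc] at h1
  have hi1 : hA.eigenvalues i = 1 := by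
    have := (mul_eq_zero.1 (h3 i)).resolve_left hi
    linarith
  refine ⟨i, hi1, fun j hj => ?_⟩
  have : hA.eigenvalues i + hA.eigenvalues j ≤ 1 := by
      rw [← h1, ← Finset.sum_pair hj.symm]
      exact Finset.sum_le_sum_of_subset_of_nonneg (Finset.subset_univ _) fun k _ _ => h0 k
  linarith [h0 j]

theorem IsPureState.exists_eq_vecMulVec {ι : Type*} [Fintype ι] [DecidableEq ι]
    {φ : Matrix ι ι ℂ} (hφ : IsPureState φ) :
    ∃ u : ι → ℂ, normSqVec u = 1 ∧ φ = vecMulVec u (star u) := by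
  have hA := hφ.1.1.isHermitian
  obtain ⟨i, hi1, hne⟩ := hφ.exists_eigenvalues hA
  set U : Matrix ι ι ℂ := (hA.eigenvectorUnitary : Matrix ι ι ℂ) with hU
  refine ⟨U *ᵥ Pi.single i 1, ?_, ?_⟩
  · rw [normSqVec_mulVec_of_star_mul_self (by simp [U]), normSqVec,
        Finset.sum_eq_single i (fun k _ hk => by simp [hk]) (by simp)]
    simp
  · conv_lhs => rw [hA.spectral_theorem, Unitary.conjStarAlgAut_apply]
    have : (diagonal (RCLike.ofReal ∘ hA.eigenvalues) : Matrix ι ι ℂ) =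
        vecMulVec (Pi.single i 1) (Pi.single i 1) := by
      ext j k
      by_cases hjk : j = k
      · subst hjk
        by_cases hj : j = i
        · subst hj; simp [vecMulVec_apply, hi1]
        · simp [vecMulVec_apply, hne j hj, hj]
      · rw [diagonal_apply_ne _ hjk, vecMulVec_apply]
        by_cases hj : j = i
        · subst hj; simp [Ne.symm hjk]
        · simp [hj]
    rw [this, mul_vecMulVec, vecMulVec_mul, ← hU]
    congr 1
    ext j
    simp [U]

/-! ### Measure of caps -/

theorem normSqVec_eq_add {n : ℕ} (i : Fin (n + 1)) (z : Fin (n + 1) → ℂ) :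
    normSqVec z = ‖z i‖ ^ 2 + ∑ j, ‖z (i.succAbove j)‖ ^ 2 := by
  rw [normSqVec, Fin.sum_univ_succAbove _ i]

theorem gaussianVec_coordinate_cap {n : ℕ} (i : Fin (n + 1)) {s : ℝ} (hs : 0 < s) (hs1 : s ≤ 1) :
    gaussianVec (n + 1) {z | (1 - s) * normSqVec z < ‖z i‖ ^ 2} = ENNReal.ofReal (s ^ n) := by
  have h := gaussianVec_quadratic i hs (fun _ : Fin n => 1 - s) (fun _ => by linarith)
  rw [Finset.prod_const, Finset.card_univ, Fintype.card_fin, add_sub_cancel, div_one,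
    ← ENNReal.ofReal_pow hs.le] at h
  rw [← h]
  congr 1
  ext z
  simp only [Set.mem_ofPred_eq]
  rw [normSqVec_eq_add i, ← Finset.mul_sum]
  constructor <;> intro h <;> linarith

theorem gaussianVec_preimage_star_eigenvectorUnitary {d : ℕ} {A : Matrix (Fin d) (Fin d) ℂ}
    (hA : A.IsHermitian) {s : Set (Fin d → ℂ)} (hs : MeasurableSet s) :
    gaussianVec d ((fun z => star (hA.eigenvectorUnitary : Matrix (Fin d) (Fin d) ℂ) *ᵥ z) ⁻¹' s) =
      gaussianVec d s :=
  (gaussianVec_preserving_mulVec_unitary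
    (Unitary.star_mem hA.eigenvectorUnitary.2)).measure_preimage hs.nullMeasurableSet

theorem measurable_normSqVec {d : ℕ} : Measurable (normSqVec : (Fin d → ℂ) → ℝ) := by
  unfold normSqVec; fun_prop

/-- The cone over a ball in projective space: the vectors whose overlap with the line through the
unit vector `x` exceeds `1 - s`. -/
noncomputable def overlapCap {d : ℕ} (x : Fin d → ℂ) (s : ℝ) : Set (Fin d → ℂ) :=
  {w | (1 - s) * normSqVec w < ‖star x ⬝ᵥ w‖ ^ 2}

/-- The unitary diagonalising the projector onto `x` turns the cap into a coordinate cap of equal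
measure. -/
theorem gaussianVec_overlapCap {n : ℕ} {x : Fin (n + 1) → ℂ} (hx : normSqVec x = 1) {s : ℝ}
    (hs : 0 < s) (hs1 : s ≤ 1) :
    gaussianVec (n + 1) (overlapCap x s) = ENNReal.ofReal (s ^ n) := by
  have hp := isPureState_vecMulVec hx
  have hA := hp.1.1.isHermitian
  obtain ⟨i, hi, hne⟩ := hp.exists_eigenvalues hA
  rw [← gaussianVec_coordinate_cap i hs hs1, ← gaussianVec_preimage_star_eigenvectorUnitary hA
    (s := {z | (1 - s) * normSqVec z < ‖z i‖ ^ 2})]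
  · congr 1
    ext w
    simp only [overlapCap, Set.mem_ofPred_eq, Set.mem_preimage]
    rw [normSqVec_star_eigenvectorUnitary_mulVec, ← quadForm_vecMulVec, quadForm_eq_sum hA,
      Finset.sum_eq_single i (fun j _ hj => by rw [hne j hj, zero_mul]) (by simp), hi, one_mul]
  · exact measurableSet_lt (measurable_normSqVec.const_mul _) (by fun_prop)

theorem IsState.sum_eigenvalues {ι : Type*} [Fintype ι] [DecidableEq ι] {ρ : Matrix ι ι ℂ}
    (hρ : IsState ρ) (hA : ρ.IsHermitian) : ∑ i, hA.eigenvalues i = 1 := by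
  rw [← trace_re_eq_sum_eigenvalues, hρ.2]; simp

/-- In an eigenbasis the form of a state is a convex combination of the `‖z i‖ ^ 2`, so some
coordinate exceeds the bound whenever the form does; then a union bound over the `n + 1` coordinate
caps. -/
theorem gaussianVec_quadForm_le {n : ℕ} {ρ : Matrix (Fin (n + 1)) (Fin (n + 1)) ℂ}
    (hρ : IsState ρ) {ε : ℝ} (hε : 0 < ε) (hε1 : ε ≤ 1) :
    gaussianVec (n + 1) {w | (1 - ε) * normSqVec w < quadForm ρ w} ≤
      ENNReal.ofReal ((n + 1) * ε ^ n) := by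
  have hA := hρ.1.isHermitian
  have hm : ∀ i : Fin (n + 1), MeasurableSet
      {z : Fin (n + 1) → ℂ | (1 - ε) * normSqVec z < ‖z i‖ ^ 2} :=
    fun i => measurableSet_lt (measurable_normSqVec.const_mul _) (by fun_prop)
  calc _ ≤ gaussianVec (n + 1) ((fun z => star (hA.eigenvectorUnitary :
          Matrix (Fin (n + 1)) (Fin (n + 1)) ℂ) *ᵥ z) ⁻¹'
          ⋃ i, {z | (1 - ε) * normSqVec z < ‖z i‖ ^ 2}) := by
        refine MeasureTheory.measure_mono fun w hw => ?_
        simp only [Set.mem_ofPred_eq, Set.mem_preimage, Set.mem_iUnion] at hw ⊢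
        by_contra! hc
        rw [quadForm_eq_sum hA, ← normSqVec_star_eigenvectorUnitary_mulVec hA] at hw
        refine hw.not_ge ((Finset.sum_le_sum fun i _ =>
          mul_le_mul_of_nonneg_left (hc i) (hρ.1.eigenvalues_nonneg i)).trans ?_)
        rw [← Finset.sum_mul, hρ.sum_eigenvalues hA, one_mul]
    _ = gaussianVec (n + 1) (⋃ i, {z | (1 - ε) * normSqVec z < ‖z i‖ ^ 2}) :=
        gaussianVec_preimage_star_eigenvectorUnitary hA (MeasurableSet.iUnion hm)
    _ ≤ ∑ i, gaussianVec (n + 1) {z | (1 - ε) * normSqVec z < ‖z i‖ ^ 2} :=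
        (MeasureTheory.measure_iUnion_le _).trans (tsum_fintype _).le
    _ = _ := by
        simp_rw [gaussianVec_coordinate_cap _ hε hε1]
        rw [Finset.sum_const, Finset.card_univ, Fintype.card_fin, nsmul_eq_mul,
          ENNReal.ofReal_mul (by positivity)]
        congr 1
        rw [← ENNReal.ofReal_natCast]; push_cast; rfl

/-! ### Lower bounds by volume counting -/

theorem one_le_of_forall_mem_iUnion {n N : ℕ} (S : Fin N → Set (Fin (n + 1) → ℂ)) {c : ℝ}
    (hS : ∀ w, w ≠ 0 → ∃ x, w ∈ S x)
    (h : ∀ x, gaussianVec (n + 1) (S x) ≤ ENNReal.ofReal c) : 1 ≤ N * c := by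
  have h1 : (1 : ENNReal) ≤ ENNReal.ofReal (N * c) := by
    calc (1 : ENNReal) = gaussianVec (n + 1) Set.univ := MeasureTheory.measure_univ.symm
      _ ≤ gaussianVec (n + 1) ({0} ∪ ⋃ x, S x) := by
          refine MeasureTheory.measure_mono fun w _ => ?_
          by_cases hw : w = 0
          · exact Or.inl hw
          · exact Or.inr (Set.mem_iUnion.2 (hS w hw))
      _ ≤ gaussianVec (n + 1) {0} + ∑ x, gaussianVec (n + 1) (S x) :=
          (MeasureTheory.measure_union_le _ _).trans
            (add_le_add le_rfl ((MeasureTheory.measure_iUnion_le _).trans (tsum_fintype _).le))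
      _ ≤ 0 + ∑ _x : Fin N, ENNReal.ofReal c :=
          add_le_add (gaussianVec_singleton_zero (Nat.succ_pos n)).le
            (Finset.sum_le_sum fun x _ => h x)
      _ = _ := by
          rw [zero_add, Finset.sum_const, Finset.card_univ, Fintype.card_fin, nsmul_eq_mul,
            ENNReal.ofReal_mul (by positivity), ENNReal.ofReal_natCast]
  rwa [ENNReal.one_le_ofReal] at h1

theorem exists_unit_eq_smul {ι : Type*} [Fintype ι] {w : ι → ℂ} (hw : w ≠ 0) :
    ∃ u : ι → ℂ, normSqVec u = 1 ∧ w = (√(normSqVec w) : ℂ) • u := by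
  have hp := normSqVec_pos hw
  have hs : (√(normSqVec w) : ℂ) ≠ 0 := by exact_mod_cast (Real.sqrt_pos.2 hp).ne'
  refine ⟨(√(normSqVec w) : ℂ)⁻¹ • w, ?_, by rw [smul_inv_smul₀ hs]⟩
  rw [normSqVec_smul, norm_inv, Complex.norm_real, Real.norm_of_nonneg (Real.sqrt_nonneg _),
    inv_pow, Real.sq_sqrt hp.le, inv_mul_cancel₀ hp.ne']

theorem quadForm_smul {ι : Type*} [Fintype ι] (A : Matrix ι ι ℂ) (c : ℂ) (v : ι → ℂ) :
    quadForm A (c • v) = ‖c‖ ^ 2 * quadForm A v := by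
  have : star (c • v) ⬝ᵥ A *ᵥ (c • v) = ((‖c‖ ^ 2 : ℝ) : ℂ) * (star v ⬝ᵥ A *ᵥ v) := by
    rw [mulVec_smul, star_smul, smul_dotProduct, dotProduct_smul, smul_eq_mul, smul_eq_mul,
      ← mul_assoc, Complex.star_def, Complex.conj_mul']
    push_cast; rfl
  rw [quadForm, this, Complex.re_ofReal_mul, quadForm]

theorem quadForm_smul_left {ι : Type*} [Fintype ι] (A : Matrix ι ι ℂ) (c : ℝ) (v : ι → ℂ) :
    quadForm ((c : ℂ) • A) v = c * quadForm A v := by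
  rw [quadForm, smul_mulVec, dotProduct_smul, smul_eq_mul, Complex.re_ofReal_mul, quadForm]

theorem quadForm_sum {X ι : Type*} [Fintype ι] (s : Finset X) (A : X → Matrix ι ι ℂ)
    (v : ι → ℂ) : quadForm (∑ x ∈ s, A x) v = ∑ x ∈ s, quadForm (A x) v := by
  simp [quadForm, sum_mulVec, dotProduct_sum]

theorem IsState.exists_weights {X : Type*} [Fintype X] {σ : Matrix X X ℂ} (hσ : IsState σ) :
    ∃ p : X → ℝ, (∀ x, 0 ≤ p x) ∧ ∑ x, p x = 1 ∧ ∀ x, σ x x = (p x : ℂ) := by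
  have h : ∀ x, 0 ≤ σ x x := fun x => hσ.1.diag_nonneg
  have e : ∀ x, σ x x = ((σ x x).re : ℂ) := fun x =>
    (Complex.ext rfl (by simpa using (Complex.le_def.1 (h x)).2.symm))
  refine ⟨fun x => (σ x x).re, fun x => (Complex.le_def.1 (h x)).1, ?_, e⟩
  have := congrArg Complex.re hσ.2
  simpa [trace] using this

theorem isState_sum_smul {X ι : Type*} [Fintype X] [Fintype ι] {ρ : X → Matrix ι ι ℂ}
    (hρ : ∀ x, IsState (ρ x)) {p : X → ℝ} (hp : ∀ x, 0 ≤ p x) (hp1 : ∑ x, p x = 1) :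
    IsState (∑ x, (p x : ℂ) • ρ x) := by
  refine ⟨posSemidef_sum _ fun x _ => (hρ x).1.smul (Complex.zero_le_real.2 (hp x)), ?_⟩
  rw [trace_sum]
  simp only [trace_smul, (hρ _).2, smul_eq_mul, mul_one]
  exact_mod_cast hp1

theorem ProbabilisticEncoding.one_le {n N : ℕ} {ε : ℝ} (hε : 0 < ε) (hε1 : ε ≤ 1)
    (h : ProbabilisticEncoding (n + 1) (Fin N) ε) : 1 ≤ N * ((n + 1) * ε ^ n) := by
  obtain ⟨ρ, hρ, h⟩ := h
  refine one_le_of_forall_mem_iUnion (fun x => {w | (1 - ε) * normSqVec w < quadForm (ρ x) w})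
    (fun w hw => ?_) fun x => gaussianVec_quadForm_le (hρ x) hε hε1
  obtain ⟨u, hu, hwu⟩ := exists_unit_eq_smul hw
  have hp := normSqVec_pos hw
  have hu0 : u ≠ 0 := by
    rintro rfl
    simp [normSqVec] at hu
  obtain ⟨σ, hσ, hlt⟩ := h _ (isPureState_vecMulVec hu)
  obtain ⟨p, hp0, hp1, hpσ⟩ := hσ.exists_weights
  rw [cqChannel] at hlt
  simp_rw [hpσ] at hlt
  have h1 := quadForm_lt_of_halfTraceNorm_lt (isPureState_vecMulVec hu).1
    (isState_sum_smul hρ hp0 hp1) hlt hu0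
  rw [hu, quadForm_vecMulVec, star_dotProduct_self, hu, quadForm_sum] at h1
  simp only [quadForm_smul_left] at h1
  -- An average above `1 - ε` has a term above `1 - ε`.
  have h2 : ∃ x, 1 - ε < quadForm (ρ x) u := by
    by_contra! hc
    have : ∑ x, p x * quadForm (ρ x) u ≤ ∑ x, p x * (1 - ε) :=
      Finset.sum_le_sum fun x _ => mul_le_mul_of_nonneg_left (hc x) (hp0 x)
    rw [← Finset.sum_mul, hp1] at this
    simp at h1
    linarith
  obtain ⟨x, hx⟩ := h2
  refine ⟨x, ?_⟩
  rw [Set.mem_ofPred_eq, hwu, normSqVec_smul, quadForm_smul, hu, mul_one, mul_comm]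
  refine mul_lt_mul_of_pos_left hx ?_
  rw [Complex.norm_real, Real.norm_of_nonneg (Real.sqrt_nonneg _), Real.sq_sqrt hp.le]
  exact hp

/-- The set is empty unless some `l i + ε > 1`. In that case it is a cone of the form in
`gaussianVec_quadratic`, whose `j`-th factor is at most `ε (l j + ε) ≤ ε² exp (l j / ε)`. The
remaining `l j` sum to `1 - l i < ε`, so the exponentials together cost at most `e`. -/
theorem gaussianVec_resolvent_le {n : ℕ} {l : Fin (n + 1) → ℝ} (hl : ∀ i, 0 ≤ l i)
    (hl1 : ∑ i, l i = 1) {ε : ℝ} (hε : 0 < ε) (hε2 : ε ≤ 1 / 2) :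
    gaussianVec (n + 1) {z | ∑ i, ‖z i‖ ^ 2 / (l i + ε) < normSqVec z} ≤
      ENNReal.ofReal (Real.exp 1 * ε ^ (2 * n)) := by
  by_cases hi : ∃ i, 1 < l i + ε
  · obtain ⟨i, hi⟩ := hi
    rw [Fin.sum_univ_succAbove _ i] at hl1
    have hle : ∀ j, l (i.succAbove j) ≤ 1 - l i := fun j => by
      rw [← hl1, add_sub_cancel_left]
      exact Finset.single_le_sum (f := fun j => l (i.succAbove j)) (fun k _ => hl _)
        (Finset.mem_univ j)
    have h := gaussianVec_quadratic i (a := 1 - 1 / (l i + ε)) (by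
        rw [sub_pos, div_lt_one (by linarith)]; exact hi)
      (fun j => 1 / (l (i.succAbove j) + ε) - 1) (fun j => by
        have := hl (i.succAbove j)
        rw [sub_nonneg, le_div_iff₀ (by linarith)]
        linarith [hle j])
    have hset : {z : Fin (n + 1) → ℂ | ∑ i, ‖z i‖ ^ 2 / (l i + ε) < normSqVec z} =
        {z | ∑ j, (1 / (l (i.succAbove j) + ε) - 1) * ‖z (i.succAbove j)‖ ^ 2 <
          (1 - 1 / (l i + ε)) * ‖z i‖ ^ 2} := by
      ext z
      simp only [Set.mem_ofPred_eq]
      rw [normSqVec_eq_add i, Fin.sum_univ_succAbove _ i]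
      simp only [sub_mul, one_mul, Finset.sum_sub_distrib, one_div_mul_eq_div]
      constructor <;> intro h <;> linarith
    rw [hset, h, ← ENNReal.ofReal_prod_of_nonneg]
    · refine ENNReal.ofReal_le_ofReal ?_
      have hfac : ∀ j, (1 - 1 / (l i + ε)) / (1 - 1 / (l i + ε) +
          (1 / (l (i.succAbove j) + ε) - 1)) ≤ ε ^ 2 * Real.exp (l (i.succAbove j) / ε) := by
        intro j
        have h0 := hl (i.succAbove j)
        have h1 := hle j
        have h2 : 0 < l i - l (i.succAbove j) := by linarith
        have e : (1 - 1 / (l i + ε)) / (1 - 1 / (l i + ε) + (1 / (l (i.succAbove j) + ε) - 1)) =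
            (l i + ε - 1) / (l i - l (i.succAbove j)) * (l (i.succAbove j) + ε) := by
          have : 0 < l i + ε := by linarith
          have : 0 < l (i.succAbove j) + ε := by linarith
          have e2 : 1 - 1 / (l i + ε) + (1 / (l (i.succAbove j) + ε) - 1) =
            (l i - l (i.succAbove j)) / ((l i + ε) * (l (i.succAbove j) + ε)) := by
              field_simp; ring
          rw [e2]
          field_simp
        rw [e]
        -- With `l j ≤ 1 - l i` this reduces to `(1 - 2ε) (1 - l i) ≥ 0`, which is where `ε ≤ 1/2`
        -- enters.
        have h3 : (l i + ε - 1) / (l i - l (i.succAbove j)) ≤ ε := by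
          rw [div_le_iff₀ h2]
          nlinarith
        calc _ ≤ ε * (l (i.succAbove j) + ε) :=
              mul_le_mul_of_nonneg_right h3 (by linarith)
          _ = ε ^ 2 * (l (i.succAbove j) / ε + 1) := by field_simp
          _ ≤ _ := mul_le_mul_of_nonneg_left (Real.add_one_le_exp _) (by positivity)
      refine (Finset.prod_le_prod (fun j _ => ?_) fun j _ => hfac j).trans ?_
      · have : 0 < 1 - 1 / (l i + ε) := by
          rw [sub_pos, div_lt_one (by linarith)]; exact hi
        have h0 := hl (i.succAbove j)
        have : 0 ≤ 1 / (l (i.succAbove j) + ε) - 1 := by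
          rw [sub_nonneg, le_div_iff₀ (by linarith)]
          linarith [hle j]
        positivity
      · rw [Finset.prod_mul_distrib, Finset.prod_const, Finset.card_univ, Fintype.card_fin,
          ← pow_mul, ← Real.exp_sum, ← Finset.sum_div, mul_comm]
        refine mul_le_mul_of_nonneg_right (Real.exp_le_exp.2 ?_) (by positivity)
        rw [div_le_one hε]
        linarith
    · intro j _
      have : 0 < 1 - 1 / (l i + ε) := by
        rw [sub_pos, div_lt_one (by linarith)]; exact hi
      have h0 := hl (i.succAbove j)
      have : 0 ≤ 1 / (l (i.succAbove j) + ε) - 1 := by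
        rw [sub_nonneg, le_div_iff₀ (by linarith)]
        linarith [hle j]
      positivity
  · push Not at hi
    have : {z : Fin (n + 1) → ℂ | ∑ i, ‖z i‖ ^ 2 / (l i + ε) < normSqVec z} = ∅ := by
      refine Set.eq_empty_of_forall_notMem fun z hz => ?_
      rw [Set.mem_ofPred_eq] at hz
      refine hz.not_ge (Finset.sum_le_sum fun i _ => ?_)
      exact le_div_self (by positivity) (by linarith [hl i]) (hi i)
    rw [this, MeasureTheory.measure_empty]
    exact zero_le

theorem gaussianVec_quadForm_ball_le {n : ℕ} {ρ : Matrix (Fin (n + 1)) (Fin (n + 1)) ℂ}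
    (hρ : IsState ρ) {ε : ℝ} (hε : 0 < ε) (hε2 : ε ≤ 1 / 2) :
    gaussianVec (n + 1) {w | w ≠ 0 ∧ ∀ v, v ≠ 0 → ‖star w ⬝ᵥ v‖ ^ 2 <
      normSqVec w * (quadForm ρ v + ε * normSqVec v)} ≤
      ENNReal.ofReal (Real.exp 1 * ε ^ (2 * n)) := by
  have hA := hρ.1.isHermitian
  have hl := hρ.1.eigenvalues_nonneg
  refine le_trans ?_ (gaussianVec_resolvent_le hl (hρ.sum_eigenvalues hA) hε hε2)
  rw [← gaussianVec_preimage_star_eigenvectorUnitary hA (s := {z | ∑ i, ‖z i‖ ^ 2 /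
    (hA.eigenvalues i + ε) < normSqVec z})]
  · refine MeasureTheory.measure_mono fun w hw => ?_
    obtain ⟨hw0, hw⟩ := hw
    simp only [Set.mem_preimage, Set.mem_ofPred_eq]
    set U := (hA.eigenvectorUnitary : Matrix (Fin (n + 1)) (Fin (n + 1)) ℂ) with hU
    set z := star U *ᵥ w with hz
    have hUU : U * star U = 1 := by simp [U]
    have hUU' : star U * U = 1 := by simp [U]
    have hwz : w = U *ᵥ z := by rw [hz, mulVec_mulVec, hUU, one_mulVec]
    -- The eigenbasis coordinates of `(ρ + ε)⁻¹ w`, the test vector that is optimal by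
    -- Cauchy–Schwarz. The hypothesis becomes `S ^ 2 < normSqVec w * S`.
    set y : Fin (n + 1) → ℂ := fun i => ((hA.eigenvalues i + ε)⁻¹ : ℝ) * z i with hy
    have hnz : normSqVec z = normSqVec w := normSqVec_star_eigenvectorUnitary_mulVec hA w
    have hpos := normSqVec_pos hw0
    set S := ∑ i, ‖z i‖ ^ 2 / (hA.eigenvalues i + ε) with hS
    have h1 : star w ⬝ᵥ (U *ᵥ y) = (S : ℂ) := by
      rw [dotProduct_mulVec]
      have : star w ᵥ* U = star z := by
        rw [hz, star_mulVec, star_eq_conjTranspose, conjTranspose_conjTranspose]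
      rw [this, hS]
      simp only [dotProduct, hy, Pi.star_apply]
      push_cast
      refine Finset.sum_congr rfl fun i _ => ?_
      rw [← Complex.conj_mul', Complex.star_def]
      ring
    have hS0 : 0 < S := by
      rw [← hnz] at hpos
      have : ∃ i, 0 < ‖z i‖ ^ 2 := by
        by_contra! hc
        exact hpos.not_ge (Finset.sum_nonpos fun i _ => hc i)
      obtain ⟨i, hi⟩ := this
      refine Finset.sum_pos' (fun i _ => ?_) ⟨i, Finset.mem_univ i, ?_⟩
      · have := hl i
        positivity
      · have := hl i
        positivity
    have hv0 : U *ᵥ y ≠ 0 := by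
      intro h
      rw [h, dotProduct_zero] at h1
      exact hS0.ne (by exact_mod_cast h1)
    have h2 := hw _ hv0
    have h3 : quadForm ρ (U *ᵥ y) + ε * normSqVec (U *ᵥ y) = S := by
      rw [hU, quadForm_eigenvector_combination hA, ← hU, normSqVec_mulVec_of_star_mul_self hUU',
        normSqVec, Finset.mul_sum, ← Finset.sum_add_distrib, hS]
      refine Finset.sum_congr rfl fun i _ => ?_
      have := hl i
      have : 0 < hA.eigenvalues i + ε := by linarith
      simp only [hy, norm_mul, Complex.norm_real, mul_pow, Real.norm_eq_abs, sq_abs]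
      field_simp
    rw [h1, h3, Complex.norm_real, Real.norm_of_nonneg hS0.le, sq, ← hnz] at h2
    exact lt_of_mul_lt_mul_right h2 hS0.le
  · exact measurableSet_lt (by fun_prop) measurable_normSqVec

theorem DeterministicEncoding.one_le {n N : ℕ} {ε : ℝ} (hε : 0 < ε) (hε2 : ε ≤ 1 / 2)
    (h : DeterministicEncoding (n + 1) (Fin N) ε) : 1 ≤ N * (Real.exp 1 * ε ^ (2 * n)) := by
  obtain ⟨ρ, hρ, h⟩ := h
  refine one_le_of_forall_mem_iUnion _ (fun w hw => ?_)
    fun x => gaussianVec_quadForm_ball_le (hρ x) hε hε2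
  obtain ⟨u, hu, hwu⟩ := exists_unit_eq_smul hw
  have hp := normSqVec_pos hw
  obtain ⟨x, hlt⟩ := h _ (isPureState_vecMulVec hu)
  refine ⟨x, hw, fun v hv => ?_⟩
  have h1 := quadForm_lt_of_halfTraceNorm_lt (isPureState_vecMulVec hu).1 (hρ x) hlt hv
  rw [quadForm_vecMulVec] at h1
  have h2 : ‖star w ⬝ᵥ v‖ ^ 2 = normSqVec w * ‖star u ⬝ᵥ v‖ ^ 2 := by
    conv_lhs => rw [hwu]
    rw [star_smul, smul_dotProduct, norm_smul, mul_pow, norm_star, Complex.norm_real,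
      Real.norm_of_nonneg (Real.sqrt_nonneg _), Real.sq_sqrt hp.le]
  rw [h2]
  exact mul_lt_mul_of_pos_left (by linarith) hp

/-! ### Economical coverings in a space with homogeneous balls -/

section Covering

open MeasureTheory

variable {Ω M : Type*} [MeasurableSpace Ω] [MetricSpace M] [MeasurableSpace M] [BorelSpace M]
  [SecondCountableTopology M]

/-- Averaging over the centre, some ball meets `U` in its average proportion. -/
theorem exists_measureReal_diff_ball_le (μ : Measure Ω) [IsProbabilityMeasure μ] {f : Ω → M}
    (hf : Measurable f) {G : Set Ω} (hG : μ Gᶜ = 0) {v r : ℝ} (hv : 0 ≤ v)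
    (h : ∀ x ∈ G, μ {w | dist (f w) (f x) < r} = ENNReal.ofReal v) {U : Set Ω}
    (hU : MeasurableSet U) :
    ∃ x ∈ G, μ.real (U \ {w | dist (f w) (f x) < r}) ≤ (1 - v) * μ.real U := by
  have hB : ∀ x, MeasurableSet {w | dist (f w) (f x) < r} := fun x =>
    measurableSet_lt (hf.dist measurable_const) measurable_const
  have hT : MeasurableSet {p : Ω × Ω | p.2 ∈ U ∧ dist (f p.2) (f p.1) < r} :=
    (measurable_snd hU).inter (measurableSet_lt
      ((hf.comp measurable_snd).dist (hf.comp measurable_fst)) measurable_const)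
  have h1 : ∫⁻ x, μ (U ∩ {w | dist (f w) (f x) < r}) ∂μ = ENNReal.ofReal v * μ U := by
    calc _ = (μ.prod μ) {p : Ω × Ω | p.2 ∈ U ∧ dist (f p.2) (f p.1) < r} :=
          (Measure.prod_apply hT).symm
      _ = ∫⁻ w, μ ((fun x => (x, w)) ⁻¹' {p : Ω × Ω | p.2 ∈ U ∧ dist (f p.2) (f p.1) < r}) ∂μ :=
          Measure.prod_apply_symm hT
      _ = ∫⁻ w, U.indicator (fun _ => ENNReal.ofReal v) w ∂μ := by
          -- By symmetry of the distance, the centres whose ball contains `w` form the ball about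
          -- `w`, of measure `v`.
          refine lintegral_congr_ae ?_
          filter_upwards [compl_mem_ae_iff.2 hG] with w hw
          rw [compl_compl] at hw
          by_cases hwU : w ∈ U
          · rw [Set.indicator_of_mem hwU, ← h w hw]
            congr 1
            ext x
            simp [hwU, dist_comm]
          · rw [Set.indicator_of_notMem hwU]
            convert! measure_empty (μ := μ)
            ext x
            simp [hwU]
      _ = _ := by rw [lintegral_indicator_const hU]
  obtain ⟨x, hx, hle⟩ := exists_notMem_null_lintegral_le (μ := μ)
    (f := fun x => μ (U ∩ {w | dist (f w) (f x) < r})) (by rw [h1]; finiteness) hG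
  refine ⟨x, not_not.1 hx, ?_⟩
  rw [h1] at hle
  have h2 : v * μ.real U ≤ μ.real (U ∩ {w | dist (f w) (f x) < r}) := by
    have := ENNReal.toReal_mono (by finiteness) hle
    rwa [ENNReal.toReal_mul, ENNReal.toReal_ofReal hv] at this
  have h3 := measureReal_inter_add_sdiff (μ := μ) (s := U) (hB x)
  linarith

/-- Greedy choice: each new centre removes at least the proportion `v` of what is still uncovered.
-/
theorem exists_finset_measureReal_compl_le (μ : Measure Ω) [IsProbabilityMeasure μ] {f : Ω → M}
    (hf : Measurable f) {G : Set Ω} (hG : μ Gᶜ = 0) {v r : ℝ} (hv : 0 ≤ v) (hv1 : v ≤ 1)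
    (h : ∀ x ∈ G, μ {w | dist (f w) (f x) < r} = ENNReal.ofReal v) (k : ℕ) :
    ∃ C : Finset Ω, (C : Set Ω) ⊆ G ∧ C.card ≤ k ∧
      μ.real {w | ∀ c ∈ C, r ≤ dist (f w) (f c)} ≤ (1 - v) ^ k := by
  classical
  induction k with
  | zero => exact ⟨∅, by simp, by simp, by simp⟩
  | succ k ih =>
    obtain ⟨C, hCG, hC, hle⟩ := ih
    have hm : MeasurableSet {w | ∀ c ∈ C, r ≤ dist (f w) (f c)} := by
      have : {w | ∀ c ∈ C, r ≤ dist (f w) (f c)} = ⋂ c ∈ C, {w | r ≤ dist (f w) (f c)} := by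
        ext; simp
      rw [this]
      exact Finset.measurableSet_biInter _ fun c _ =>
        measurableSet_le measurable_const (hf.dist measurable_const)
    obtain ⟨x, hx, hxle⟩ := exists_measureReal_diff_ball_le μ hf hG hv h hm
    refine ⟨insert x C, ?_, (Finset.card_insert_le x C).trans (by omega), ?_⟩
    · rw [Finset.coe_insert]
      exact Set.insert_subset hx hCG
    · have : {w | ∀ c ∈ insert x C, r ≤ dist (f w) (f c)} =
          {w | ∀ c ∈ C, r ≤ dist (f w) (f c)} \ {w | dist (f w) (f x) < r} := by
        ext w
        simp [and_comm]
      rw [this, pow_succ, mul_comm]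
      exact hxle.trans (mul_le_mul_of_nonneg_left hle (by linarith))

/-- Random balls of radius `(1 - t) δ`, completed by a maximal `δ`-separated set of uncovered
points, give an economical `δ`-covering. -/
theorem exists_covering (μ : Measure Ω) [IsProbabilityMeasure μ] {f : Ω → M}
    (hf : Measurable f) {G : Set Ω} (hG : μ Gᶜ = 0) {m : ℕ}
    (h : ∀ x ∈ G, ∀ r, 0 < r → r ≤ 1 →
      μ {w | dist (f w) (f x) < r} = ENNReal.ofReal (r ^ m))
    {δ t : ℝ} (hδ : 0 < δ) (hδ1 : δ ≤ 1) (ht : 0 < t) (ht2 : t ≤ 1 / 2) (k : ℕ) :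
    ∃ C : Finset Ω, (C : Set Ω) ⊆ G ∧ (∀ x ∈ G, ∃ c ∈ C, dist (f x) (f c) < δ) ∧
      (C.card : ℝ) ≤ k + (1 - ((1 - t) * δ) ^ m) ^ k / (t * δ) ^ m := by
  classical
  have hr0 : 0 < (1 - t) * δ := mul_pos (by linarith) hδ
  have hr1 : (1 - t) * δ ≤ 1 := by nlinarith
  have hs0 : 0 < t * δ := mul_pos ht hδ
  have hs1 : t * δ ≤ 1 := by nlinarith
  obtain ⟨C, hCG, hCk, hC⟩ := exists_finset_measureReal_compl_le μ hf hG
    (pow_nonneg hr0.le m) (pow_le_one₀ hr0.le hr1) (fun x hx => h x hx _ hr0 hr1) k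
  let good : Finset Ω → Prop := fun Y => (Y : Set Ω) ⊆ G ∧
    (∀ y ∈ Y, ∀ c ∈ C, δ ≤ dist (f y) (f c)) ∧
    ∀ y ∈ Y, ∀ z ∈ Y, y ≠ z → δ ≤ dist (f y) (f z)
  have hbound : ∀ Y, good Y →
      (Y.card : ℝ) ≤ (1 - ((1 - t) * δ) ^ m) ^ k / (t * δ) ^ m := by
    rintro Y ⟨hYG, hYC, hYY⟩
    rw [le_div_iff₀ (by positivity)]
    refine le_trans ?_ hC
    have hB : ∀ x, MeasurableSet {w | dist (f w) (f x) < t * δ} := fun x =>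
      measurableSet_lt (hf.dist measurable_const) measurable_const
    -- Since `t ≤ 1/2`, balls of radius `t δ` about `δ`-separated points are disjoint.
    have hdisj : Set.PairwiseDisjoint (Y : Set Ω) fun y => {w | dist (f w) (f y) < t * δ} := by
      intro y hy z hz hyz
      refine Set.disjoint_left.2 fun w hw hw' => ?_
      simp only [Set.mem_ofPred_eq] at hw hw'
      have h1 := hYY y hy z hz hyz
      have h2 := dist_triangle_left (f y) (f z) (f w)
      nlinarith
    calc (Y.card : ℝ) * (t * δ) ^ m = ∑ y ∈ Y, μ.real {w | dist (f w) (f y) < t * δ} := by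
          rw [Finset.sum_congr rfl fun y hy => by
            rw [measureReal_def, h y (hYG hy) _ hs0 hs1,
              ENNReal.toReal_ofReal (pow_nonneg hs0.le m)]]
          simp
      _ = μ.real (⋃ y ∈ Y, {w | dist (f w) (f y) < t * δ}) :=
          (measureReal_biUnion_finset hdisj fun y _ => hB y).symm
      _ ≤ _ := by
          -- A point within `t δ` of some `y` that is `δ`-far from `C` stays at distance at least
          -- `(1 - t) δ` from `C`, so these balls lie in the small uncovered set.
          refine measureReal_mono fun w hw c hc => ?_
          simp only [Set.mem_iUnion, Set.mem_ofPred_eq] at hw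
          obtain ⟨y, hy, hw⟩ := hw
          have h1 := hYC y hy c hc
          have h2 := dist_triangle_left (f y) (f c) (f w)
          linarith
  -- The packing bound makes a largest such set exist; a point left `δ`-far from `C ∪ Y` could be
  -- added to it.
  obtain ⟨Y, hY, hmax⟩ : ∃ Y, good Y ∧ ∀ Z, good Z → Z.card ≤ Y.card := by
    have hne : {n | ∃ Y, good Y ∧ Y.card = n}.Nonempty :=
      ⟨0, ∅, ⟨by simp, by simp, by simp⟩, by simp⟩
    have hbd : BddAbove {n | ∃ Y, good Y ∧ Y.card = n} := by
      refine ⟨⌊(1 - ((1 - t) * δ) ^ m) ^ k / (t * δ) ^ m⌋₊, ?_⟩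
      rintro _ ⟨Y, hY, rfl⟩
      exact Nat.le_floor (hbound Y hY)
    obtain ⟨Y, hY, hYc⟩ := Nat.sSup_mem hne hbd
    exact ⟨Y, hY, fun Z hZ => hYc ▸ le_csSup hbd ⟨Z, hZ, rfl⟩⟩
  refine ⟨C ∪ Y, ?_, fun x hx => ?_, ?_⟩
  · rw [Finset.coe_union]
    exact Set.union_subset hCG hY.1
  · by_contra! hc
    have hxC : ∀ c ∈ C, δ ≤ dist (f x) (f c) := fun c hcC => hc c (Finset.mem_union_left _ hcC)
    have hxY : ∀ y ∈ Y, δ ≤ dist (f x) (f y) := fun c hcC => hc c (Finset.mem_union_right _ hcC)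
    have hxn : x ∉ Y := fun hxY' => by
      have := hxY x hxY'
      rw [dist_self] at this
      linarith
    have : good (insert x Y) := by
      refine ⟨?_, ?_, ?_⟩
      · rw [Finset.coe_insert]
        exact Set.insert_subset hx hY.1
      · intro y hy
        rcases Finset.mem_insert.1 hy with rfl | hy
        · exact hxC
        · exact hY.2.1 y hy
      · intro y hy z hz hyz
        rcases Finset.mem_insert.1 hy with rfl | hy' <;>
          rcases Finset.mem_insert.1 hz with rfl | hz'
        · exact absurd rfl hyz
        · exact hxY z hz'
        · rw [dist_comm]; exact hxY y hy'
        · exact hY.2.2 y hy' z hz' hyz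
    have := hmax _ this
    rw [Finset.card_insert_of_notMem hxn] at this
    omega
  · calc ((C ∪ Y).card : ℝ) ≤ (C.card : ℝ) + Y.card := by exact_mod_cast Finset.card_union_le C Y
      _ ≤ _ := add_le_add (by exact_mod_cast hCk) (hbound Y hY)

end Covering

/-! ### Coverings of projective space -/

/-- The projector onto the line through `w`, scaled so that the Euclidean distance becomes the
trace distance. -/
noncomputable def lineProjector {d : ℕ} (w : Fin d → ℂ) : EuclideanSpace ℂ (Fin d × Fin d) :=
  WithLp.toLp 2 fun p => ((√2 * normSqVec w)⁻¹ : ℝ) • (w p.1 * star (w p.2))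

theorem measurable_lineProjector {d : ℕ} :
    Measurable (lineProjector : (Fin d → ℂ) → EuclideanSpace ℂ (Fin d × Fin d)) := by
  unfold lineProjector
  refine (WithLp.measurable_toLp 2 _).comp (measurable_pi_lambda _ fun p => ?_)
  have := measurable_normSqVec (d := d)
  have h1 : Measurable fun w : Fin d → ℂ => w p.1 * star (w p.2) := by
    have : Continuous fun w : Fin d → ℂ => w p.1 * star (w p.2) := by fun_prop
    exact this.measurable
  exact ((this.const_mul _).inv).smul h1

theorem inner_lineProjector {d : ℕ} (v w : Fin d → ℂ) :
    inner ℂ (lineProjector v) (lineProjector w) =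
      ((‖star v ⬝ᵥ w‖ ^ 2 / (2 * (normSqVec v * normSqVec w)) : ℝ) : ℂ) := by
  rw [PiLp.inner_apply, Fintype.sum_prod_type]
  have h2 : (√2 : ℂ) * √2 = 2 := by
    exact_mod_cast Real.mul_self_sqrt (by norm_num : (0 : ℝ) ≤ 2)
  have : ∀ i j, inner ℂ (lineProjector v (i, j)) (lineProjector w (i, j)) =
      ((2 * (normSqVec v * normSqVec w))⁻¹ : ℝ) *
        ((star (v i) * w i) * star (star (v j) * w j)) := by
    intro i j
    simp only [lineProjector, RCLike.inner_apply, Complex.real_smul, map_mul, Complex.conj_ofReal,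
      Complex.star_def, Complex.conj_conj]
    push_cast
    rw [← h2]
    simp only [mul_inv]
    ring
  simp_rw [this, ← Finset.mul_sum, ← Finset.sum_mul]
  rw [← star_sum]
  have e : ∑ i, star (v i) * w i = star v ⬝ᵥ w := rfl
  rw [e, Complex.star_def, Complex.mul_conj']
  push_cast
  ring

theorem dist_lineProjector_sq {d : ℕ} {v w : Fin d → ℂ} (hv : v ≠ 0) (hw : w ≠ 0) :
    dist (lineProjector v) (lineProjector w) ^ 2 =
      1 - ‖star v ⬝ᵥ w‖ ^ 2 / (normSqVec v * normSqVec w) := by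
  have hn : ∀ {u : Fin d → ℂ}, u ≠ 0 → ‖lineProjector u‖ ^ 2 = 1 / 2 := by
    intro u hu
    have hp := normSqVec_pos hu
    rw [norm_sq_eq_re_inner (𝕜 := ℂ), inner_lineProjector, star_dotProduct_self,
      Complex.norm_real, Real.norm_of_nonneg hp.le, RCLike.re_eq_complex_re, Complex.ofReal_re]
    field_simp
  rw [dist_eq_norm, norm_sub_sq (𝕜 := ℂ), hn hv, hn hw, inner_lineProjector]
  have := normSqVec_pos hv
  have := normSqVec_pos hw
  rw [RCLike.re_eq_complex_re, Complex.ofReal_re]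
  field_simp
  ring

theorem dist_lineProjector_lt_iff {d : ℕ} {v w : Fin d → ℂ} (hv : v ≠ 0) (hw : w ≠ 0) {r : ℝ}
    (hr : 0 < r) : dist (lineProjector v) (lineProjector w) < r ↔
      (1 - r ^ 2) * (normSqVec v * normSqVec w) < ‖star v ⬝ᵥ w‖ ^ 2 := by
  have := normSqVec_pos hv
  have := normSqVec_pos hw
  rw [← pow_lt_pow_iff_left₀ dist_nonneg hr.le two_ne_zero, dist_lineProjector_sq hv hw,
    sub_lt_comm, lt_div_iff₀ (by positivity)]

theorem norm_star_dotProduct_comm {ι : Type*} [Fintype ι] (v w : ι → ℂ) :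
    ‖star v ⬝ᵥ w‖ = ‖star w ⬝ᵥ v‖ := by
  rw [star_dotProduct, norm_star]

theorem gaussianVec_dist_lineProjector_lt {n : ℕ} {v : Fin (n + 1) → ℂ} (hv : v ≠ 0) {r : ℝ}
    (hr : 0 < r) (hr1 : r ≤ 1) :
    gaussianVec (n + 1) {w | dist (lineProjector w) (lineProjector v) < r} =
      ENNReal.ofReal (r ^ (2 * n)) := by
  obtain ⟨u, hu, hvu⟩ := exists_unit_eq_smul hv
  have hp := normSqVec_pos hv
  rw [pow_mul, ← gaussianVec_overlapCap hu (pow_pos hr 2) (pow_le_one₀ hr.le hr1)]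
  refine MeasureTheory.measure_congr ?_
  have h0 : ∀ᵐ w ∂gaussianVec (n + 1), w ≠ 0 :=
    MeasureTheory.compl_mem_ae_iff.2 (gaussianVec_singleton_zero (Nat.succ_pos n))
  filter_upwards [h0] with w hw
  refine propext ((dist_lineProjector_lt_iff hw hv hr).trans ?_)
  have h2 : ‖star w ⬝ᵥ v‖ ^ 2 = normSqVec v * ‖star u ⬝ᵥ w‖ ^ 2 := by
    conv_lhs => rw [hvu]
    rw [dotProduct_smul, norm_smul, mul_pow, Complex.norm_real, norm_star_dotProduct_comm w,
      Real.norm_of_nonneg (Real.sqrt_nonneg _), Real.sq_sqrt hp.le]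
  rw [h2, ← mul_assoc, mul_comm _ (normSqVec v)]
  exact mul_lt_mul_iff_right₀ hp

/-- Every pure state has overlap greater than `1 - s` with one of at most
`k + (1 - ((1 - t)² s)ⁿ)ᵏ / (t² s)ⁿ` pure states. -/
theorem exists_overlap_covering (n : ℕ) {s t : ℝ} (hs : 0 < s) (hs1 : s ≤ 1) (ht : 0 < t)
    (ht2 : t ≤ 1 / 2) (k : ℕ) :
    ∃ (N : ℕ) (x : Fin N → Fin (n + 1) → ℂ), (∀ i, normSqVec (x i) = 1) ∧
      (∀ u, normSqVec u = 1 → ∃ i, 1 - s < ‖star (x i) ⬝ᵥ u‖ ^ 2) ∧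
      (N : ℝ) ≤ k + (1 - (1 - t) ^ (2 * n) * s ^ n) ^ k / (t ^ (2 * n) * s ^ n) := by
  obtain ⟨C, hCG, hC, hcard⟩ := exists_covering (gaussianVec (n + 1)) measurable_lineProjector
    (G := {w | w ≠ 0}) (m := 2 * n)
    (by
      have : {w : Fin (n + 1) → ℂ | w ≠ 0}ᶜ = {0} := by ext; simp
      rw [this]
      exact gaussianVec_singleton_zero (Nat.succ_pos n))
    (fun x hx r hr hr1 => gaussianVec_dist_lineProjector_lt hx hr hr1)
    (Real.sqrt_pos.2 hs) (Real.sqrt_le_one.2 hs1) ht ht2 k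
  have hpow : √s ^ (2 * n) = s ^ n := by rw [pow_mul, Real.sq_sqrt hs.le]
  rw [mul_pow, mul_pow, hpow] at hcard
  have hex : ∀ i : Fin C.card, ∃ u : Fin (n + 1) → ℂ, normSqVec u = 1 ∧
      ((C.equivFin.symm i : Fin (n + 1) → ℂ)) =
        (√(normSqVec (C.equivFin.symm i : Fin (n + 1) → ℂ)) : ℂ) • u :=
    fun i => exists_unit_eq_smul (hCG (C.equivFin.symm i).2)
  choose x hx hxe using hex
  refine ⟨C.card, x, hx, fun u hu => ?_, hcard⟩
  have hu0 : u ≠ 0 := by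
    rintro rfl
    simp [normSqVec] at hu
  obtain ⟨c, hc, hlt⟩ := hC u hu0
  have hc0 : c ≠ 0 := hCG hc
  have hp := normSqVec_pos hc0
  refine ⟨C.equivFin ⟨c, hc⟩, ?_⟩
  have h1 := hxe (C.equivFin ⟨c, hc⟩)
  simp only [Equiv.symm_apply_apply] at h1
  rw [dist_lineProjector_lt_iff hu0 hc0 (Real.sqrt_pos.2 hs), hu, one_mul,
    Real.sq_sqrt hs.le] at hlt
  have h2 : ‖star u ⬝ᵥ c‖ ^ 2 = normSqVec c * ‖star (x (C.equivFin ⟨c, hc⟩)) ⬝ᵥ u‖ ^ 2 := by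
    conv_lhs => rw [h1]
    rw [dotProduct_smul, norm_smul, mul_pow, Complex.norm_real, norm_star_dotProduct_comm u,
      Real.norm_of_nonneg (Real.sqrt_nonneg _), Real.sq_sqrt hp.le]
  rw [h2, mul_comm] at hlt
  exact lt_of_mul_lt_mul_left hlt hp.le

/-! ### From coverings to encodings -/

/-- Splitting `u` and `v` along `x` and its complement bounds `‖⟨u, v⟩‖` by `C A + S B`. A weighted
Cauchy–Schwarz inequality, with weights adapted to `ε`, compares its square with `A ^ 2 + ε`. -/
theorem norm_inner_sq_sub_lt {E : Type*} [NormedAddCommGroup E] [InnerProductSpace ℂ E]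
    {x u v : E} (hx : ‖x‖ = 1) (hu : ‖u‖ = 1) (hv : ‖v‖ = 1) {ε : ℝ} (hε : 0 < ε)
    (h : 1 - ε ^ 2 < ‖inner ℂ x u‖ ^ 2) :
    ‖inner ℂ u v‖ ^ 2 - ‖inner ℂ x v‖ ^ 2 < ε := by
  have hres : ∀ w : E, ‖w‖ = 1 → ‖w - inner ℂ x w • x‖ ^ 2 = 1 - ‖inner ℂ x w‖ ^ 2 := by
    intro w hw
    rw [norm_sub_sq (𝕜 := ℂ), hw, inner_smul_right, ← inner_conj_symm w x, Complex.mul_conj',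
      norm_smul, hx]
    have : RCLike.re ((‖inner ℂ x w‖ : ℂ) ^ 2) = ‖inner ℂ x w‖ ^ 2 := by
      rw [← Complex.ofReal_pow]; exact Complex.ofReal_re _
    rw [this]
    ring
  have hdec : inner ℂ u v = inner ℂ u x * inner ℂ x v +
      inner ℂ (u - inner ℂ x u • x) (v - inner ℂ x v • x) := by
    rw [inner_sub_left, inner_sub_right, inner_sub_right, inner_smul_left, inner_smul_left,
      inner_smul_right, inner_smul_right, inner_conj_symm, inner_self_eq_norm_sq_to_K, hx]
    simp
    ring
  set C := ‖inner ℂ x u‖ with hC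
  set A := ‖inner ℂ x v‖ with hA
  set S := ‖u - inner ℂ x u • x‖ with hS
  set B := ‖v - inner ℂ x v • x‖ with hB
  have hS2 : S ^ 2 = 1 - C ^ 2 := hres u hu
  have hB2 : B ^ 2 = 1 - A ^ 2 := hres v hv
  have hle : ‖inner ℂ u v‖ ≤ C * A + S * B := by
    rw [hdec]
    have h1 : ‖inner ℂ u x * inner ℂ x v‖ = C * A := by rw [norm_mul, norm_inner_symm u x]
    rw [← h1]
    exact (norm_add_le _ _).trans (by gcongr; exact norm_inner_le_norm _ _)
  have hsq : ‖inner ℂ u v‖ ^ 2 ≤ (C * A + S * B) ^ 2 := pow_le_pow_left₀ (norm_nonneg _) hle 2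
  have hpos : 0 < A ^ 2 + ε := by positivity
  -- The weights `1 + ε` and `ε` are chosen so that the second factor is `A ^ 2 + ε` and the first
  -- is below `ε (1 + ε)`.
  have h1 : ε * (1 + ε) * (C * A + S * B) ^ 2 ≤
      (ε * C ^ 2 + (1 + ε) * S ^ 2) * ((1 + ε) * A ^ 2 + ε * B ^ 2) := by
    nlinarith [sq_nonneg (ε * C * B - (1 + ε) * S * A)]
  rw [hS2, hB2] at h1
  have h2 : (ε * C ^ 2 + (1 + ε) * (1 - C ^ 2)) * ((1 + ε) * A ^ 2 + ε * (1 - A ^ 2)) <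
      ε * (1 + ε) * (A ^ 2 + ε) := by
    have e : (1 + ε) * A ^ 2 + ε * (1 - A ^ 2) = A ^ 2 + ε := by ring
    rw [e]
    exact mul_lt_mul_of_pos_right (by nlinarith) hpos
  have h3 := lt_of_mul_lt_mul_left (h1.trans_lt h2) (by positivity)
  linarith

theorem star_dotProduct_eq_inner {ι : Type*} [Fintype ι] (v w : ι → ℂ) :
    star v ⬝ᵥ w = inner ℂ (WithLp.toLp 2 v : EuclideanSpace ℂ ι) (WithLp.toLp 2 w) := by
  rw [EuclideanSpace.inner_toLp_toLp, dotProduct_comm]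

theorem norm_toLp_of_normSqVec {ι : Type*} [Fintype ι] {v : ι → ℂ} (hv : normSqVec v = 1) :
    ‖(WithLp.toLp 2 v : EuclideanSpace ℂ ι)‖ = 1 := by
  rw [EuclideanSpace.norm_eq]
  have : ∑ i, ‖v i‖ ^ 2 = 1 := hv
  simp [this]

theorem deterministicEncoding_of_covering {d N : ℕ} {ε : ℝ} (hε : 0 < ε)
    {x : Fin N → Fin d → ℂ} (hx : ∀ i, normSqVec (x i) = 1)
    (h : ∀ u, normSqVec u = 1 → ∃ i, 1 - ε ^ 2 < ‖star (x i) ⬝ᵥ u‖ ^ 2) :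
    DeterministicEncoding d (Fin N) ε := by
  refine ⟨fun i => vecMulVec (x i) (star (x i)), fun i => (isPureState_vecMulVec (hx i)).1,
    fun φ hφ => ?_⟩
  obtain ⟨u, hu, rfl⟩ := hφ.exists_eq_vecMulVec
  obtain ⟨i, hi⟩ := h u hu
  refine ⟨i, halfTraceNorm_lt_of_quadForm_lt (isPureState_vecMulVec hu).1
    (isPureState_vecMulVec (hx i)).1 hε fun v hv => ?_⟩
  rw [quadForm_vecMulVec, quadForm_vecMulVec]
  rw [star_dotProduct_eq_inner] at hi ⊢
  rw [star_dotProduct_eq_inner]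
  exact norm_inner_sq_sub_lt (norm_toLp_of_normSqVec (hx i)) (norm_toLp_of_normSqVec hu)
    (norm_toLp_of_normSqVec hv) hε hi

/-- `quadForm` as a linear functional of the matrix. -/
noncomputable def quadFormLinear {ι : Type*} [Fintype ι] (v : ι → ℂ) : Matrix ι ι ℂ →ₗ[ℝ] ℝ where
  toFun A := quadForm A v
  map_add' A B := by simp [quadForm, add_mulVec, dotProduct_add]
  map_smul' c A := by
    simp [quadForm, smul_mulVec, dotProduct_smul]

theorem quadFormLinear_apply {ι : Type*} [Fintype ι] (v : ι → ℂ) (A : Matrix ι ι ℂ) :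
    quadFormLinear v A = quadForm A v := rfl

theorem continuous_quadForm {ι : Type*} [Fintype ι] (v : ι → ℂ) :
    Continuous fun A : Matrix ι ι ℂ => quadForm A v := by
  unfold quadForm
  fun_prop

theorem convex_setOf_isState (ι : Type*) [Fintype ι] :
    Convex ℝ {τ : Matrix ι ι ℂ | IsState τ} := by
  rintro A ⟨hA, hA1⟩ B ⟨hB, hB1⟩ a b ha hb hab
  refine ⟨(hA.smul ha).add (hB.smul hb), ?_⟩
  rw [trace_add, trace_smul, trace_smul, hA1, hB1, ← add_smul, hab, one_smul]

theorem IsState.norm_apply_le {ι : Type*} [Fintype ι] [DecidableEq ι] {τ : Matrix ι ι ℂ}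
    (hτ : IsState τ) (i j : ι) : ‖τ i j‖ ≤ 1 := by
  have hA := hτ.1.isHermitian
  set U := (hA.eigenvectorUnitary : Matrix ι ι ℂ) with hU
  have hij : τ i j = ∑ k, U i k * (hA.eigenvalues k : ℂ) * star (U j k) := by
    conv_lhs => rw [hA.spectral_theorem, Unitary.conjStarAlgAut_apply, mul_apply]
    refine Finset.sum_congr rfl fun k _ => ?_
    rw [mul_diagonal]
    rfl
  rw [hij, ← hτ.sum_eigenvalues hA]
  refine (norm_sum_le _ _).trans (Finset.sum_le_sum fun k _ => ?_)
  have h0 := hτ.1.eigenvalues_nonneg k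
  have h1 := entry_norm_bound_of_unitary hA.eigenvectorUnitary.2 i k
  have h2 := entry_norm_bound_of_unitary hA.eigenvectorUnitary.2 j k
  rw [norm_mul, norm_mul, norm_star, Complex.norm_real, Real.norm_of_nonneg h0]
  calc _ ≤ 1 * hA.eigenvalues k * 1 := by gcongr
    _ = _ := by ring

/-- Compactness lets Sion's theorem provide an actual saddle point, so the strict inequality
survives. -/
theorem isCompact_setOf_isState (ι : Type*) [Fintype ι] [DecidableEq ι] :
    IsCompact {τ : Matrix ι ι ℂ | IsState τ} := by
  have hc : IsCompact (Set.univ.pi fun _ : ι => Set.univ.pi fun _ : ι =>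
      Metric.closedBall (0 : ℂ) 1) :=
    isCompact_univ_pi fun _ => isCompact_univ_pi fun _ => isCompact_closedBall _ _
  refine IsCompact.of_isClosed_subset (X := Matrix ι ι ℂ) hc ?_ fun τ hτ => ?_
  · have : {τ : Matrix ι ι ℂ | IsState τ} = ({τ | τ.conjTranspose = τ} ∩
        ⋂ v : ι → ℂ, {τ | 0 ≤ star v ⬝ᵥ τ *ᵥ v}) ∩ {τ | τ.trace = 1} := by
      ext τ
      simp [IsState, posSemidef_iff_dotProduct_mulVec, IsHermitian]
    rw [this]
    refine ((isClosed_eq (by fun_prop) continuous_id).inter (isClosed_iInter fun v => ?_)).inter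
      (isClosed_eq (by fun_prop) continuous_const)
    have hcont : Continuous fun τ : Matrix ι ι ℂ => star v ⬝ᵥ τ *ᵥ v := by fun_prop
    exact isClosed_le continuous_const hcont
  · exact fun i _ j _ => mem_closedBall_zero_iff.2 (IsState.norm_apply_le hτ i j)

/-- An overlap covering beats every state used as a witness. -/
theorem exists_quadForm_sub_lt {d N : ℕ} {ε : ℝ} (hε : 0 < ε)
    {x : Fin N → Fin d → ℂ}
    (h : ∀ u, normSqVec u = 1 → ∃ i, 1 - ε < ‖star (x i) ⬝ᵥ u‖ ^ 2)
    {τ : Matrix (Fin d) (Fin d) ℂ} (hτ : IsState τ) {u : Fin d → ℂ} (hu : normSqVec u = 1) :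
    ∃ i, quadForm τ u - quadForm τ (x i) < ε := by
  have hA := hτ.1.isHermitian
  have hl := hτ.1.eigenvalues_nonneg
  have hsum := hτ.sum_eigenvalues hA
  have : Nonempty (Fin d) := by
    by_contra hne
    rw [not_nonempty_iff] at hne
    simp at hsum
  obtain ⟨k, hk⟩ := Finite.exists_max hA.eigenvalues
  have hk0 : 0 < hA.eigenvalues k := by
    by_contra! hc
    have : ∑ i, hA.eigenvalues i ≤ 0 := Finset.sum_nonpos fun i _ => (hk i).trans hc
    linarith
  have hk1 : hA.eigenvalues k ≤ 1 := hsum ▸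
    Finset.single_le_sum (f := hA.eigenvalues) (fun i _ => hl i) (Finset.mem_univ k)
  set U := (hA.eigenvectorUnitary : Matrix (Fin d) (Fin d) ℂ) with hU
  -- The label is chosen near the top eigenvector of `τ`, not near `u`: then the difference is at
  -- most `λ (1 - overlap) < λ ε ≤ ε`, with `λ` the top eigenvalue.
  obtain ⟨i, hi⟩ := h (U *ᵥ Pi.single k 1) (by
    rw [normSqVec_mulVec_of_star_mul_self (by simp [U]), normSqVec,
      Finset.sum_eq_single k (fun j _ hj => by simp [hj]) (by simp)]
    simp)
  refine ⟨i, ?_⟩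
  have h1 : quadForm τ u ≤ hA.eigenvalues k := by
    rw [quadForm_eq_sum hA]
    refine (Finset.sum_le_sum fun j _ => mul_le_mul_of_nonneg_right (hk j) (by positivity)).trans ?_
    have := normSqVec_star_eigenvectorUnitary_mulVec hA u
    rw [hu, normSqVec] at this
    rw [← Finset.mul_sum, this, mul_one]
  have h2 : (star U *ᵥ x i) k = star (U *ᵥ Pi.single k 1) ⬝ᵥ x i := by
    rw [star_mulVec, ← dotProduct_mulVec, ← star_eq_conjTranspose]
    have : star (Pi.single k 1 : Fin d → ℂ) = Pi.single k 1 := by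
      ext j
      by_cases hj : j = k
      · subst hj; simp
      · simp [hj]
    rw [this, single_one_dotProduct]
  have h3 : hA.eigenvalues k * ‖star (x i) ⬝ᵥ U *ᵥ Pi.single k 1‖ ^ 2 ≤ quadForm τ (x i) := by
    rw [quadForm_eq_sum hA, norm_star_dotProduct_comm, ← h2]
    exact Finset.single_le_sum (f := fun j => hA.eigenvalues j * ‖(star U *ᵥ x i) j‖ ^ 2)
      (fun j _ => mul_nonneg (hl j) (by positivity)) (Finset.mem_univ k)
  have h4 := mul_lt_mul_of_pos_left hi hk0
  nlinarith

theorem isState_diagonal {N : ℕ} {p : Fin N → ℝ} (hp : p ∈ stdSimplex ℝ (Fin N)) :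
    IsState (diagonal fun i => (p i : ℂ)) := by
  refine ⟨PosSemidef.diagonal fun i => Complex.zero_le_real.2 (hp.1 i), ?_⟩
  rw [trace_diagonal]
  exact_mod_cast hp.2

/-- A two-player game: weights `p` minimise and a witness state `τ` maximises the bilinear payoff
`f`. Mixed witnesses are allowed so that both strategy sets are convex. Since every fixed witness
can be beaten by one label, the saddle weights beat all witnesses at once. -/
theorem probabilisticEncoding_of_covering {n N : ℕ} {ε : ℝ} (hε : 0 < ε)
    {x : Fin N → Fin (n + 1) → ℂ} (hx : ∀ i, normSqVec (x i) = 1)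
    (h : ∀ u, normSqVec u = 1 → ∃ i, 1 - ε < ‖star (x i) ⬝ᵥ u‖ ^ 2) :
    ProbabilisticEncoding (n + 1) (Fin N) ε := by
  refine ⟨fun i => vecMulVec (x i) (star (x i)), fun i => (isPureState_vecMulVec (hx i)).1,
    fun φ hφ => ?_⟩
  obtain ⟨u, hu, rfl⟩ := hφ.exists_eq_vecMulVec
  obtain ⟨i₀, -⟩ := h u hu
  let f : (Fin N → ℝ) → Matrix (Fin (n + 1)) (Fin (n + 1)) ℂ → ℝ := fun p τ =>
    quadForm τ u - ∑ i, p i * quadForm τ (x i)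
  obtain ⟨p, hp, τ, hτ, hsaddle⟩ := Sion.exists_isSaddlePointOn (f := f)
    (X := stdSimplex ℝ (Fin N)) (Y := {τ | IsState τ}) ⟨_, single_mem_stdSimplex ℝ i₀⟩
    (convex_stdSimplex ℝ _) (isCompact_stdSimplex _ _)
    (fun τ _ => by
      refine Continuous.lowerSemicontinuous ?_ |>.lowerSemicontinuousOn _
      fun_prop)
    (fun τ _ => by
      refine ConvexOn.quasiconvexOn ?_
      refine ⟨convex_stdSimplex ℝ _, fun p _ q _ a b ha hb hab => le_of_eq ?_⟩
      simp only [f, Pi.add_apply, Pi.smul_apply, smul_eq_mul, add_mul, Finset.sum_add_distrib,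
        mul_assoc, ← Finset.mul_sum]
      linear_combination -(quadForm τ u) * hab)
    (convex_setOf_isState _) ⟨_, (isPureState_vecMulVec hu).1⟩ (isCompact_setOf_isState _)
    (fun p _ => by
      refine Continuous.upperSemicontinuous ?_ |>.upperSemicontinuousOn _
      exact (continuous_quadForm u).sub (continuous_finsetSum _ fun i _ =>
        continuous_const.mul (continuous_quadForm (x i))))
    (fun p _ => by
      refine ConcaveOn.quasiconcaveOn ?_
      exact (quadFormLinear u - ∑ i, p i • quadFormLinear (x i)).concaveOn
        (convex_setOf_isState _) |>.congr fun τ _ => by simp [f, quadFormLinear_apply])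
  obtain ⟨i, hi⟩ := exists_quadForm_sub_lt hε h hτ hu
  refine ⟨diagonal fun i => (p i : ℂ), isState_diagonal hp, ?_⟩
  have hch : cqChannel (fun i => vecMulVec (x i) (star (x i))) (diagonal fun i => (p i : ℂ)) =
      ∑ i, (p i : ℂ) • vecMulVec (x i) (star (x i)) := by
    simp [cqChannel]
  rw [hch]
  refine halfTraceNorm_lt_of_quadForm_lt (isPureState_vecMulVec hu).1
    (isState_sum_smul (fun i => (isPureState_vecMulVec (hx i)).1) hp.1 hp.2) hε fun v hv => ?_
  -- Saddle inequality: the payoff of `p` against the test vector `v` is at most that of the label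
  -- `i` against the optimal witness `τ`.
  have h1 := hsaddle _ (single_mem_stdSimplex ℝ i) _ (isPureState_vecMulVec hv).1
  have h2 : f (Pi.single i 1) τ = quadForm τ u - quadForm τ (x i) := by
    simp only [f]
    rw [Finset.sum_eq_single i (fun j _ hj => by simp [hj]) (by simp)]
    simp
  have h3 : f p (vecMulVec v (star v)) = quadForm (vecMulVec u (star u)) v -
      quadForm (∑ i, (p i : ℂ) • vecMulVec (x i) (star (x i))) v := by
    simp only [f, quadForm_sum, quadForm_smul_left, quadForm_vecMulVec,
      norm_star_dotProduct_comm v]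
  rw [← h3]
  exact h1.trans_lt (h2 ▸ hi)

end

/-! ### The constant in the covering bound -/

theorem mul_log_bound {n : ℕ} (hn : 3 ≤ n) :
    8 / 3 * (n : ℝ) * Real.log (8 * n - 1) + 7 / 3 ≤ 5 * ((n : ℝ) + 1) * Real.log (n + 1) := by
  have hn' : (3 : ℝ) ≤ n := by exact_mod_cast hn
  set d : ℝ := n + 1 with hd
  have hd4 : 4 ≤ d := by linarith
  have hnd : (n : ℝ) = d - 1 := by rw [hd]; ring
  rw [hnd]
  have h2 := Real.log_two_gt_d9
  have hlog4 : Real.log 4 = 2 * Real.log 2 := by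
    rw [show (4 : ℝ) = 2 ^ 2 by norm_num, Real.log_pow]; norm_num
  have hlog16 : Real.log 16 = 4 * Real.log 2 := by
    rw [show (16 : ℝ) = 2 ^ 4 by norm_num, Real.log_pow]; norm_num
  have hconst : Real.log (23 / 8) ≤ 1.058 := by
    have he := Real.exp_one_gt_d9
    have h := Real.log_le_sub_one_of_pos (x := 23 / 8 / Real.exp 1) (by positivity)
    rw [Real.log_div (by norm_num) (Real.exp_pos 1).ne', Real.log_exp] at h
    have : 23 / 8 / Real.exp 1 ≤ 1.058 := by
      rw [div_le_iff₀ (Real.exp_pos 1)]; linarith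
    linarith
  -- From `(8 d - 9)² ≤ (23/8)² d³`, with equality at `d = 4`.
  have hL : Real.log (8 * (d - 1) - 1) ≤ 1.058 + 3 / 2 * Real.log d := by
    have h1 : (8 * (d - 1) - 1) ^ 2 ≤ (23 / 8) ^ 2 * d ^ 3 := by
      have : 0 ≤ (d - 4) * (529 * d ^ 2 - 1980 * d + 1296) := by
        refine mul_nonneg (by linarith) ?_
        nlinarith
      nlinarith
    have h3 := Real.log_le_log (by nlinarith) h1
    rw [Real.log_mul (by norm_num) (by positivity), Real.log_pow, Real.log_pow, Real.log_pow] at h3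
    push_cast at h3
    linarith
  -- The tangent to the convex function `d log d` at `a`; below it is taken at `4` for `d ≤ 10` and
  -- at `16` beyond.
  have hlow : ∀ a : ℝ, 0 < a → (Real.log a + 1) * d - a ≤ d * Real.log d := by
    intro a ha
    have h := Real.one_sub_inv_le_log_of_pos (x := d / a) (by positivity)
    rw [Real.log_div (by linarith) ha.ne', inv_div] at h
    have h' := mul_le_mul_of_nonneg_left h (by linarith : 0 ≤ d)
    have : d * (1 - a / d) = d - a := by
      have : d ≠ 0 := by linarith
      field_simp
    linarith
  have key : 2.8214 * d - 0.488 ≤ (d + 4) * Real.log d := by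
    rcases le_total d 10 with h10 | h10
    · have h := hlow 4 (by norm_num)
      rw [hlog4] at h
      have h' : 2.386294 * d - 4 ≤ d * Real.log d := by nlinarith
      refine le_of_mul_le_mul_left ?_ (by linarith : 0 < d)
      nlinarith [mul_nonneg (sub_nonneg.2 hd4) (sub_nonneg.2 h10),
        mul_le_mul_of_nonneg_left h' (by linarith : 0 ≤ d + 4)]
    · have h := hlow 16 (by norm_num)
      rw [hlog16] at h
      have h' : 3.772588 * d - 16 ≤ d * Real.log d := by nlinarith
      refine le_of_mul_le_mul_left ?_ (by linarith : 0 < d)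
      nlinarith [mul_nonneg (by linarith : 0 ≤ d) (sub_nonneg.2 h10),
        mul_le_mul_of_nonneg_left h' (by linarith : 0 ≤ d + 4)]
  have hfin : 8 / 3 * (d - 1) * Real.log (8 * (d - 1) - 1) ≤
      8 / 3 * (d - 1) * (1.058 + 3 / 2 * Real.log d) :=
    mul_le_mul_of_nonneg_left hL (by linarith)
  nlinarith

/-- Economical coverings of the pure states on `ℂ^(n+1)`. -/
theorem exists_overlap_covering_card_le {n : ℕ} (hn : 1 ≤ n) {s : ℝ} (hs : 0 < s) (hs1 : s ≤ 1) :
    ∃ (N : ℕ) (x : Fin N → Fin (n + 1) → ℂ), (∀ i, normSqVec (x i) = 1) ∧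
      (∀ u, normSqVec u = 1 → ∃ i, 1 - s < ‖star (x i) ⬝ᵥ u‖ ^ 2) ∧
      (N : ℝ) * s ^ n ≤ 5 * ((n : ℝ) + 1) * Real.log (n + 1) := by
  have hv : 0 < s ^ n := pow_pos hs n
  have hv1 : s ^ n ≤ 1 := pow_le_one₀ hs.le hs1
  have h2 := Real.log_two_gt_d9
  -- For `n ≤ 2` the bare packing bound `4 ^ n`, with no greedy step and `t = 1/2`, is enough.
  rcases Nat.lt_or_ge n 3 with h3 | h3
  · obtain ⟨N, x, hx, hcov, hN⟩ := exists_overlap_covering n hs hs1 (t := 1 / 2) (by norm_num)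
      le_rfl 0
    refine ⟨N, x, hx, hcov, ?_⟩
    rw [pow_zero, Nat.cast_zero, zero_add, le_div_iff₀ (by positivity)] at hN
    have hN' : (N : ℝ) * s ^ n ≤ 2 ^ (2 * n) := by
      have : (2 : ℝ) ^ (2 * n) * (1 / 2) ^ (2 * n) = 1 := by rw [← mul_pow]; norm_num
      calc (N : ℝ) * s ^ n = (2 : ℝ) ^ (2 * n) * (N * ((1 / 2) ^ (2 * n) * s ^ n)) := by
            linear_combination (-(N : ℝ) * s ^ n) * this
        _ ≤ 2 ^ (2 * n) * 1 := mul_le_mul_of_nonneg_left hN (by positivity)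
        _ = _ := mul_one _
    refine hN'.trans ?_
    interval_cases n
    · norm_num
      linarith
    · have hlog3 : 19 * Real.log 2 ≤ 12 * Real.log 3 := by
        have := Real.log_le_log (by norm_num) (by norm_num : (2 : ℝ) ^ 19 ≤ 3 ^ 12)
        rw [Real.log_pow, Real.log_pow] at this
        exact_mod_cast this
      norm_num
      linarith
  · have hn3 : (3 : ℝ) ≤ n := by exact_mod_cast h3
    set L := Real.log (8 * n - 1) with hL
    have hL0 : 0 ≤ L := Real.log_nonneg (by linarith)
    -- By Bernoulli this keeps `(1 - t) ^ (2n) ≥ 3/4`, and `L` is then `log ((1 - t) / t)`.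
    set t : ℝ := 1 / (8 * n) with ht
    have ht0 : 0 < t := by positivity
    have ht2 : t ≤ 1 / 2 := by
      rw [ht]; exact one_div_le_one_div_of_le (by norm_num) (by linarith)
    set q := (1 - t) ^ (2 * n) with hq
    have hq34 : 3 / 4 ≤ q := by
      have h := one_add_mul_le_pow (a := -t) (by linarith) (2 * n)
      rw [← sub_eq_add_neg] at h
      refine le_trans (le_of_eq ?_) h
      rw [ht]
      push_cast
      field_simp
      norm_num
    have hq1 : q ≤ 1 := pow_le_one₀ (by linarith) (by linarith)
    -- The number of greedy steps brings the uncovered measure down to `(t / (1 - t)) ^ (2n)`; the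
    -- factor `8/3 = 2 / (3/4)` makes up for `q ≥ 3/4`. The completion then adds at most `(4/3) / s
    -- ^ n` points.
    obtain ⟨N, x, hx, hcov, hN⟩ := exists_overlap_covering n hs hs1 ht0 ht2 ⌈8 / 3 * n * L / s ^ n⌉₊
    refine ⟨N, x, hx, hcov, ?_⟩
    set k := ⌈8 / 3 * n * L / s ^ n⌉₊ with hk
    have hk1 : (k : ℝ) ≤ 8 / 3 * n * L / s ^ n + 1 := (Nat.ceil_lt_add_one (by positivity)).le
    have hk2 : 8 / 3 * n * L ≤ k * s ^ n := by
      rw [← div_le_iff₀ hv]; exact Nat.le_ceil _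
    have hexp : (1 - q * s ^ n) ^ k ≤ (t / (1 - t)) ^ (2 * n) := by
      have h1 : 1 - q * s ^ n ≤ Real.exp (-(q * s ^ n)) := by
        have := Real.add_one_le_exp (-(q * s ^ n)); linarith
      have hqv : q * s ^ n ≤ 1 := mul_le_one₀ hq1 hv.le hv1
      calc (1 - q * s ^ n) ^ k ≤ Real.exp (-(q * s ^ n)) ^ k :=
            pow_le_pow_left₀ (by linarith) h1 k
        _ = Real.exp (-(q * (k * s ^ n))) := by rw [← Real.exp_nat_mul]; ring_nf
        _ ≤ Real.exp (-((2 * n : ℕ) * L)) := by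
            refine Real.exp_le_exp.2 (neg_le_neg ?_)
            push_cast
            calc 2 * (n : ℝ) * L = 3 / 4 * (8 / 3 * n * L) := by ring
              _ ≤ q * (k * s ^ n) := by gcongr
        _ = (t / (1 - t)) ^ (2 * n) := by
            rw [neg_eq_neg_one_mul, mul_left_comm, Real.exp_nat_mul]
            congr 1
            rw [neg_one_mul, Real.exp_neg, hL, Real.exp_log (by linarith), ht]
            have : (8 * (n : ℝ) - 1) ≠ 0 := by linarith
            have : (1 - 1 / (8 * (n : ℝ))) = (8 * n - 1) / (8 * n) := by field_simp
            rw [this]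
            field_simp
    have hN2 : (N : ℝ) ≤ k + 4 / 3 / s ^ n := by
      refine hN.trans (add_le_add le_rfl ?_)
      rw [div_le_div_iff₀ (by positivity) hv]
      have h1 : (t / (1 - t)) ^ (2 * n) ≤ 4 / 3 * t ^ (2 * n) := by
        rw [div_pow, div_le_iff₀ (by positivity)]
        nlinarith [pow_pos ht0 (2 * n)]
      nlinarith [mul_le_mul_of_nonneg_right (hexp.trans h1) hv.le]
    calc (N : ℝ) * s ^ n ≤ (8 / 3 * n * L / s ^ n + 1 + 4 / 3 / s ^ n) * s ^ n :=
          mul_le_mul_of_nonneg_right (by linarith) hv.le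
      _ = 8 / 3 * n * L + s ^ n + 4 / 3 := by field_simp
      _ ≤ 8 / 3 * n * L + 7 / 3 := by linarith
      _ ≤ _ := mul_log_bound h3

/-! ### Minimal sizes, bit lengths and limits -/

theorem minProbabilisticSize_spec {n : ℕ} (hn : 1 ≤ n) {ε : ℝ} (hε : 0 < ε) (hε1 : ε ≤ 1) :
    IsLeast (probabilisticSizes (n + 1) ε) (minProbabilisticSize (n + 1) ε) ∧
      1 ≤ minProbabilisticSize (n + 1) ε * (((n : ℝ) + 1) * ε ^ n) ∧
      minProbabilisticSize (n + 1) ε * ε ^ n ≤ 5 * ((n : ℝ) + 1) * Real.log (n + 1) := by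
  obtain ⟨N, x, hx, hcov, hN⟩ := exists_overlap_covering_card_le hn hε hε1
  have hmem : N ∈ probabilisticSizes (n + 1) ε := probabilisticEncoding_of_covering hε hx hcov
  have hmin : minProbabilisticSize (n + 1) ε ∈ probabilisticSizes (n + 1) ε :=
    Nat.sInf_mem ⟨N, hmem⟩
  refine ⟨⟨hmin, fun m hm => Nat.sInf_le hm⟩, ProbabilisticEncoding.one_le hε hε1 hmin, ?_⟩
  have hle : (minProbabilisticSize (n + 1) ε : ℝ) ≤ N := by exact_mod_cast Nat.sInf_le hmem
  exact (mul_le_mul_of_nonneg_right hle (by positivity)).trans hN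

theorem minDeterministicSize_spec {n : ℕ} (hn : 1 ≤ n) {ε : ℝ} (hε : 0 < ε) (hε1 : ε ≤ 1) :
    IsLeast (deterministicSizes (n + 1) ε) (minDeterministicSize (n + 1) ε) ∧
      (ε ≤ 1 / 2 → 1 ≤ minDeterministicSize (n + 1) ε * (Real.exp 1 * ε ^ (2 * n))) ∧
      minDeterministicSize (n + 1) ε * ε ^ (2 * n) ≤ 5 * ((n : ℝ) + 1) * Real.log (n + 1) := by
  obtain ⟨N, x, hx, hcov, hN⟩ := exists_overlap_covering_card_le hn (pow_pos hε 2)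
    (pow_le_one₀ hε.le hε1)
  have hmem : N ∈ deterministicSizes (n + 1) ε := deterministicEncoding_of_covering hε hx hcov
  have hmin : minDeterministicSize (n + 1) ε ∈ deterministicSizes (n + 1) ε :=
    Nat.sInf_mem ⟨N, hmem⟩
  refine ⟨⟨hmin, fun m hm => Nat.sInf_le hm⟩,
    fun hε2 => DeterministicEncoding.one_le hε hε2 hmin, ?_⟩
  have hle : (minDeterministicSize (n + 1) ε : ℝ) ≤ N := by exact_mod_cast Nat.sInf_le hmem
  rw [pow_mul]
  exact (mul_le_mul_of_nonneg_right hle (by positivity)).trans hN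

/-- Applied with `c = ε ^ n`, `a = d` and with `c = ε ^ (2n)`, `a = e`. The lower bound also rules
out `N = 0`, where `logb` has a default value. -/
theorem logb_bounds {N : ℕ} {a b c : ℝ} (ha : 0 < a) (hc : 0 < c)
    (h1 : 1 ≤ N * (a * c)) (h2 : N * c ≤ b) :
    1 ≤ N ∧ Real.logb 2 (1 / c) - Real.logb 2 a ≤ Real.logb 2 N ∧
      Real.logb 2 N ≤ Real.logb 2 (1 / c) + Real.logb 2 b := by
  have hN : 1 ≤ N := by
    rcases Nat.eq_zero_or_pos N with rfl | h
    · norm_num at h1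
    · exact h
  have hN0 : (0 : ℝ) < N := by exact_mod_cast hN
  have hb : 0 < b := (mul_pos hN0 hc).trans_le h2
  refine ⟨hN, ?_, ?_⟩
  · rw [← Real.logb_div (by positivity) ha.ne']
    refine Real.logb_le_logb_of_le (by norm_num) (by positivity) ?_
    rw [div_div, div_le_iff₀ (by positivity)]
    linarith [mul_comm a c]
  · rw [← Real.logb_mul (by positivity) hb.ne']
    refine Real.logb_le_logb_of_le (by norm_num) hN0 ?_
    rw [one_div_mul_eq_div, le_div_iff₀ hc]
    exact h2

theorem logb_one_div_pow (ε : ℝ) (m : ℕ) :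
    Real.logb 2 (1 / ε ^ m) = m * Real.logb 2 (1 / ε) := by
  rw [← one_div_pow, Real.logb_pow]

theorem logb_le_bitLength (N : ℕ) : Real.logb 2 N ≤ bitLength N := Nat.le_ceil _

theorem bitLength_le {N : ℕ} (hN : 1 ≤ N) : (bitLength N : ℝ) ≤ Real.logb 2 N + 1 :=
  (Nat.ceil_lt_add_one (Real.logb_nonneg (by norm_num) (by exact_mod_cast hN))).le

theorem logb_five_mul_log_le {d : ℝ} (hd : 2 ≤ d) :
    Real.logb 2 (5 * d * Real.log d) ≤ 2 * Real.logb 2 d + 3 := by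
  have hlog : 0 < Real.log d := Real.log_pos (by linarith)
  have hle : Real.log d ≤ d := (Real.log_le_sub_one_of_pos (by linarith)).trans (by linarith)
  have h1 : Real.logb 2 (5 * d * Real.log d) ≤ Real.logb 2 (2 ^ 3 * d ^ 2) := by
    refine Real.logb_le_logb_of_le (by norm_num) (by positivity) ?_
    nlinarith
  rw [Real.logb_mul (x := 2 ^ 3) (by norm_num) (by positivity), Real.logb_pow, Real.logb_pow,
    Real.logb_self_eq_one (by norm_num)] at h1
  push_cast at h1
  linarith

/-- Rounding up costs at most one bit. The error does not depend on `ε` and is `o(d)`, so the same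
estimate yields both limits. -/
theorem abs_bitLength_minProbabilisticSize_sub_le {d : ℕ} (hd : 2 ≤ d) {ε : ℝ} (hε : 0 < ε)
    (hε1 : ε ≤ 1) :
    |(bitLength (minProbabilisticSize d ε) : ℝ) - ((d : ℝ) - 1) * Real.logb 2 (1 / ε)| ≤
      2 * Real.logb 2 d + 4 := by
  obtain ⟨n, rfl⟩ : ∃ n, d = n + 1 := ⟨d - 1, by omega⟩
  obtain ⟨-, h1, h2⟩ := minProbabilisticSize_spec (n := n) (by omega) hε hε1
  obtain ⟨hN, hlo, hhi⟩ := logb_bounds (by positivity) (pow_pos hε n) h1 h2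
  rw [logb_one_div_pow] at hlo hhi
  have hd' : (2 : ℝ) ≤ ((n + 1 : ℕ) : ℝ) := by exact_mod_cast hd
  have h3 := logb_five_mul_log_le hd'
  have h4 : 0 ≤ Real.logb 2 ((n + 1 : ℕ) : ℝ) := Real.logb_nonneg (by norm_num) (by linarith)
  have h5 := logb_le_bitLength (minProbabilisticSize (n + 1) ε)
  have h6 := bitLength_le hN
  push_cast at h3 h4 ⊢
  rw [add_sub_cancel_right, abs_le]
  constructor <;> linarith

theorem abs_bitLength_minDeterministicSize_sub_le {d : ℕ} (hd : 2 ≤ d) {ε : ℝ} (hε : 0 < ε)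
    (hε2 : ε ≤ 1 / 2) :
    |(bitLength (minDeterministicSize d ε) : ℝ) - 2 * ((d : ℝ) - 1) * Real.logb 2 (1 / ε)| ≤
      2 * Real.logb 2 d + 4 := by
  obtain ⟨n, rfl⟩ : ∃ n, d = n + 1 := ⟨d - 1, by omega⟩
  obtain ⟨-, h1, h2⟩ := minDeterministicSize_spec (n := n) (by omega) hε (by linarith)
  obtain ⟨hN, hlo, hhi⟩ := logb_bounds (Real.exp_pos 1) (pow_pos hε (2 * n)) (h1 hε2) h2
  rw [logb_one_div_pow] at hlo hhi
  have hd' : (2 : ℝ) ≤ ((n + 1 : ℕ) : ℝ) := by exact_mod_cast hd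
  have h3 := logb_five_mul_log_le hd'
  have h4 : 0 ≤ Real.logb 2 ((n + 1 : ℕ) : ℝ) := Real.logb_nonneg (by norm_num) (by linarith)
  have h5 := logb_le_bitLength (minDeterministicSize (n + 1) ε)
  have h6 := bitLength_le hN
  -- The loss from the factor `e` in the volume bound, absorbed by the constant `4`.
  have h7 : Real.logb 2 (Real.exp 1) ≤ 2 := by
    rw [Real.logb_le_iff_le_rpow (by norm_num) (Real.exp_pos 1)]
    have := Real.exp_one_lt_d9
    norm_num
    linarith
  push_cast at h3 h4 hlo hhi ⊢
  rw [add_sub_cancel_right, abs_le]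
  constructor <;> linarith

theorem tendsto_div_natCast_of_abs_sub_le {B : ℕ → ℝ} {K : ℝ}
    (h : ∀ d : ℕ, 2 ≤ d → |B d - K * ((d : ℝ) - 1)| ≤ 2 * Real.logb 2 d + 4) :
    Tendsto (fun d : ℕ => B d / d) atTop (𝓝 K) := by
  have hlog : Tendsto (fun d : ℕ => Real.log d / d) atTop (𝓝 0) :=
    (Real.isLittleO_log_id_atTop.tendsto_div_nhds_zero).comp tendsto_natCast_atTop_atTop
  have hg : Tendsto (fun d : ℕ => 2 / Real.log 2 * (Real.log d / d) + (4 + |K|) / d) atTop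
      (𝓝 0) := by
    simpa using (hlog.const_mul (2 / Real.log 2)).add
      (tendsto_const_div_atTop_nhds_zero_nat (4 + |K|))
  rw [tendsto_iff_dist_tendsto_zero]
  refine squeeze_zero' (Eventually.of_forall fun d => dist_nonneg) ?_ hg
  filter_upwards [eventually_ge_atTop 2] with d hd
  have hd0 : (0 : ℝ) < d := by exact_mod_cast (by omega : 0 < d)
  have h1 : B d / d - K = ((B d - K * ((d : ℝ) - 1)) - K) / d := by field_simp; ring
  have h2 : 2 / Real.log 2 * (Real.log d / d) + (4 + |K|) / d =
      (2 * Real.logb 2 d + 4 + |K|) / d := by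
    rw [Real.logb]; ring
  rw [Real.dist_eq, h1, h2, abs_div, abs_of_pos hd0]
  refine div_le_div_of_nonneg_right ?_ hd0.le
  exact (abs_sub _ _).trans (add_le_add (h d hd) le_rfl)

theorem tendsto_div_neg_logb_of_abs_sub_le {B : ℝ → ℝ} {K C : ℝ}
    (h : ∀ ε : ℝ, 0 < ε → ε ≤ 1 / 2 → |B ε - K * Real.logb 2 (1 / ε)| ≤ C) :
    Tendsto (fun ε : ℝ => B ε / (-Real.logb 2 ε)) (𝓝[>] 0) (𝓝 K) := by
  have hlog : Tendsto (fun ε : ℝ => -Real.logb 2 ε) (𝓝[>] 0) atTop :=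
    tendsto_neg_atBot_atTop.comp (Real.tendsto_logb_nhdsGT_zero (by norm_num))
  have hg : Tendsto (fun ε : ℝ => C / (-Real.logb 2 ε)) (𝓝[>] 0) (𝓝 0) :=
    hlog.const_div_atTop C
  rw [tendsto_iff_dist_tendsto_zero]
  refine squeeze_zero' (Eventually.of_forall fun ε => dist_nonneg) ?_ hg
  filter_upwards [Ioc_mem_nhdsGT (by norm_num : (0 : ℝ) < 1 / 2)] with ε hε
  have hpos : 0 < -Real.logb 2 ε :=
    neg_pos.2 (Real.logb_neg (by norm_num) hε.1 (by linarith [hε.2]))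
  have h1 := h ε hε.1 hε.2
  rw [one_div, Real.logb_inv] at h1
  have h2 : B ε / (-Real.logb 2 ε) - K = (B ε - K * (-Real.logb 2 ε)) / (-Real.logb 2 ε) := by
    rw [sub_div, mul_div_cancel_right₀ _ hpos.ne']
  rw [Real.dist_eq, h2, abs_div, abs_of_pos hpos]
  exact div_le_div_of_nonneg_right h1 hpos.le

theorem theorem2 :
    -- the most compact encodings exist, and the probabilistic one obeys the two bounds
    (∀ (d : ℕ) (ε : ℝ), 2 ≤ d → 0 < ε → ε ≤ 1 →
      IsLeast (probabilisticSizes d ε) (minProbabilisticSize d ε) ∧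
      IsLeast (deterministicSizes d ε) (minDeterministicSize d ε) ∧
      ((d : ℝ) - 1) * Real.logb 2 (1 / ε) - Real.logb 2 d
        ≤ Real.logb 2 (minProbabilisticSize d ε) ∧
      Real.logb 2 (minProbabilisticSize d ε)
        ≤ ((d : ℝ) - 1) * Real.logb 2 (1 / ε) + Real.logb 2 (5 * d * Real.log d)) ∧
    -- bit rate per dimension: probabilistic, and twice as large for deterministic encodings
    (∀ ε : ℝ, 0 < ε → ε ≤ 1 →
      Tendsto (fun d : ℕ => (bitLength (minProbabilisticSize d ε) : ℝ) / d) atTop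
        (𝓝 (Real.logb 2 (1 / ε)))) ∧
    (∀ ε : ℝ, 0 < ε → ε ≤ 1 / 2 →
      Tendsto (fun d : ℕ => (bitLength (minDeterministicSize d ε) : ℝ) / d) atTop
        (𝓝 (2 * Real.logb 2 (1 / ε)))) ∧
    -- bit rate per precision: probabilistic, and twice as large for deterministic encodings
    (∀ d : ℕ, 2 ≤ d →
      Tendsto (fun ε : ℝ => (bitLength (minProbabilisticSize d ε) : ℝ) / (-Real.logb 2 ε))
        (𝓝[>] 0) (𝓝 ((d : ℝ) - 1)) ∧
      Tendsto (fun ε : ℝ => (bitLength (minDeterministicSize d ε) : ℝ) / (-Real.logb 2 ε))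
        (𝓝[>] 0) (𝓝 (2 * ((d : ℝ) - 1)))) := by
  refine ⟨fun d ε hd hε hε1 => ?_, fun ε hε hε1 => ?_, fun ε hε hε2 => ?_, fun d hd => ⟨?_, ?_⟩⟩
  · obtain ⟨n, rfl⟩ : ∃ n, d = n + 1 := ⟨d - 1, by omega⟩
    obtain ⟨hp, h1, h2⟩ := minProbabilisticSize_spec (n := n) (by omega) hε hε1
    obtain ⟨hdet, -, -⟩ := minDeterministicSize_spec (n := n) (by omega) hε hε1
    obtain ⟨-, hlo, hhi⟩ := logb_bounds (by positivity) (pow_pos hε n) h1 h2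
    rw [logb_one_div_pow] at hlo hhi
    push_cast
    rw [add_sub_cancel_right]
    exact ⟨hp, hdet, hlo, hhi⟩
  · refine tendsto_div_natCast_of_abs_sub_le fun d hd => ?_
    rw [mul_comm]
    exact abs_bitLength_minProbabilisticSize_sub_le hd hε hε1
  · refine tendsto_div_natCast_of_abs_sub_le fun d hd => ?_
    rw [mul_right_comm]
    exact abs_bitLength_minDeterministicSize_sub_le hd hε hε2
  · exact tendsto_div_neg_logb_of_abs_sub_le fun ε hε hε2 =>
      abs_bitLength_minProbabilisticSize_sub_le hd hε (by linarith)
  · exact tendsto_div_neg_logb_of_abs_sub_le fun ε hε hε2 =>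
      abs_bitLength_minDeterministicSize_sub_le hd hε hε2
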